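/- Let $\mathbb{K}$ be a field, let $G$ be a finite simple graph with vertex set $V(G)=\{x_1,\dots,x_n\}$, and let $S=\mathbb{K}[x_1,\dots,x_n]$ with the standard grading. Let $I(G)=(x_ix_j : x_ix_j\in E(G))\subseteq S$ be the edge ideal of $G$; for $s\ge 1$ let the $s$-th squarefree power $I(G)^{[s]}$ be the ideal of $S$ generated by the squarefree monomials that belong to $I(G)^s$; and let $\mathrm{match}(G)$ be the largest number of edges in a matching of $G$. For a nonzero homogeneous ideal $I$ of $S$ with graded Betti numbers $\beta_{i,j}(I)$ (the number of summands $S(-j)$ in homological degree $i$ of the minimal graded free resolution of $I$), let $\mathrm{reg}(I)=\max\{j-i : \beta_{i,j}(I)\neq 0\}$ be its Castelnuovo--Mumford regularity. Then for every integer $s$ with $1\le s\le \mathrm{match}(G)$, $$\mathrm{reg}\big(I(G)^{[s]}\big)\le s+\lfloor n/2\rfloor .$$ In particular, if $G$ has a matching of size $\lfloor n/2\rfloor$, then for every integer $s$ with $1\le s\le \mathrm{match}(G)$, $$\mathrm{reg}\big(I(G)^{[s]}\big)\le \mathrm{match}(G)+s .$$ -/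

import Mathlib

noncomputable section

/-! ### Graded free modules over a standard graded polynomial ring -/

namespace GradedRes

open MvPolynomial

variable {σ K : Type*} [Field K]

attribute [local instance] MvPolynomial.gradedAlgebra

/-- For a family of integers `d`, the vector `v` is homogeneous of degree `e` in the graded free
module `⨁ k, S(-d k)`, where `S = K[x_a : a ∈ σ]` has the standard grading: every monomial that
occurs in the coordinate `v k` has degree `e - d k`. (The zero vector is homogeneous of every
degree.) -/
def IsHomogeneousVec {ι : Type*} (d : ι → ℤ) (e : ℤ) (v : ι → MvPolynomial σ K) : Prop :=
  ∀ k, ∀ μ ∈ (v k).support, (μ.degree : ℤ) + d k = e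

/-- A minimal graded free resolution
`⋯ ⟶ ⨁ k, S(-deg 1 k) ⟶ ⨁ k, S(-deg 0 k) ⟶ I ⟶ 0`
of an ideal `I` of `S = K[x_a : a ∈ σ]` (viewed as an `S`-module, graded as a submodule of `S`).
The free modules have finite rank, the maps are homogeneous of degree zero, the sequence is exact,
and the image of each differential lies in `𝔪 F_i`, where `𝔪` is the ideal generated by the
variables, i.e. the ideal of all polynomials with constant coefficient zero. -/
structure MinimalGradedFreeResolution (I : Ideal (MvPolynomial σ K)) where
  /-- the rank of the `i`-th free module -/
  rank : ℕ → ℕ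
  /-- the degrees of the basis elements of the `i`-th free module -/
  deg : ∀ i, Fin (rank i) → ℤ
  /-- the augmentation `F_0 ⟶ I ⊆ S` -/
  aug : (Fin (rank 0) → MvPolynomial σ K) →ₗ[MvPolynomial σ K] MvPolynomial σ K
  /-- the differential `F_{i+1} ⟶ F_i` -/
  diff : ∀ i, (Fin (rank (i + 1)) → MvPolynomial σ K) →ₗ[MvPolynomial σ K]
    (Fin (rank i) → MvPolynomial σ K)
  aug_homogeneous : ∀ k, ∀ μ ∈ (aug (Pi.single k 1)).support, (μ.degree : ℤ) = deg 0 k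
  diff_homogeneous : ∀ i k, IsHomogeneousVec (deg i) (deg (i + 1) k) (diff i (Pi.single k 1))
  range_aug : LinearMap.range aug = I
  exact_zero : Function.Exact (diff 0) aug
  exact_succ : ∀ i, Function.Exact (diff (i + 1)) (diff i)
  minimal : ∀ i v l, constantCoeff (diff i v l) = 0

/-! ### Existence of minimal graded free resolutions -/

/-- The homogeneous component of (integer) degree `m` of a polynomial. -/
def hc (m : ℤ) (p : MvPolynomial σ K) : MvPolynomial σ K :=
  if 0 ≤ m then homogeneousComponent m.toNat p else 0

theorem coeff_hc (m : ℤ) (p : MvPolynomial σ K) (μ : σ →₀ ℕ) :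
    coeff μ (hc m p) = if (μ.degree : ℤ) = m then coeff μ p else 0 := by
  unfold hc
  by_cases hm : 0 ≤ m
  · rw [if_pos hm, coeff_homogeneousComponent]
    congr 1
    apply propext
    omega
  · rw [if_neg hm, if_neg (by omega), coeff_zero]

theorem hc_mul (m c : ℤ) (p g : MvPolynomial σ K)
    (hg : ∀ μ ∈ g.support, (μ.degree : ℤ) = c) : hc m (p * g) = hc (m - c) p * g := by
  classical
  ext μ
  rw [coeff_hc, coeff_mul, coeff_mul]
  have key : ∀ x ∈ Finset.HasAntidiagonal.antidiagonal μ,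
      (if (μ.degree : ℤ) = m then coeff x.1 p * coeff x.2 g else 0)
        = coeff x.1 (hc (m - c) p) * coeff x.2 g := by
    intro x hx
    rw [coeff_hc]
    by_cases h0 : coeff x.2 g = 0
    · simp [h0]
    · have h1 := hg x.2 (by simpa [mem_support_iff] using h0)
      have h2 : x.1.degree + x.2.degree = μ.degree := by
        rw [← Finset.HasAntidiagonal.mem_antidiagonal.1 hx, map_add]
      have h3 : ((μ.degree : ℤ) = m) ↔ ((x.1.degree : ℤ) = m - c) := by omega
      simp only [h3]
      split_ifs <;> simp
  rw [← Finset.sum_congr rfl key]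
  split_ifs <;> simp

theorem hc_zero (m : ℤ) : hc m (0 : MvPolynomial σ K) = 0 := by
  ext μ; simp [coeff_hc]

theorem hc_sum {ι : Type*} (m : ℤ) (s : Finset ι) (f : ι → MvPolynomial σ K) :
    hc m (∑ i ∈ s, f i) = ∑ i ∈ s, hc m (f i) := by
  ext μ
  rw [coeff_hc, coeff_sum, coeff_sum]
  simp only [coeff_hc]
  split_ifs <;> simp

theorem hc_zero_eq_C (p : MvPolynomial σ K) : hc 0 p = C (constantCoeff p) := by
  simp [hc, homogeneousComponent_zero, constantCoeff_eq]

/-- The homogeneous component of degree `e` of a vector of `⨁ k, S(-d k)`. -/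
def comp {ι : Type*} (d : ι → ℤ) (e : ℤ) (v : ι → MvPolynomial σ K) : ι → MvPolynomial σ K :=
  fun k => hc (e - d k) (v k)

theorem isHomogeneousVec_comp {ι : Type*} (d : ι → ℤ) (e : ℤ) (v : ι → MvPolynomial σ K) :
    IsHomogeneousVec d e (comp d e v) := by
  intro k μ hμ
  rw [mem_support_iff, comp, coeff_hc] at hμ
  by_contra h
  exact hμ (if_neg (by omega))

theorem exists_sum_comp {ι : Type*} [Finite ι] (d : ι → ℤ) (v : ι → MvPolynomial σ K) :
    ∃ T : Finset ℤ, v = ∑ e ∈ T, comp d e v := by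
  classical
  cases nonempty_fintype ι
  refine ⟨Finset.univ.biUnion fun k => (v k).support.image fun μ => (μ.degree : ℤ) + d k, ?_⟩
  funext k
  ext μ
  rw [Finset.sum_apply, coeff_sum]
  simp only [comp, coeff_hc]
  by_cases h : coeff μ (v k) = 0
  · simp [h]
  · rw [Finset.sum_eq_single ((μ.degree : ℤ) + d k)]
    · simp
    · intro b _ hb
      exact if_neg (by omega)
    · intro hn
      exact absurd (Finset.mem_biUnion.2 ⟨k, Finset.mem_univ _,
        Finset.mem_image.2 ⟨μ, by simpa [mem_support_iff] using h, rfl⟩⟩) hn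

/-- A submodule of `⨁ k, S(-d k)` is graded if it contains the homogeneous components of its
elements. -/
def IsGradedSubmodule {ι : Type*} (d : ι → ℤ)
    (N : Submodule (MvPolynomial σ K) (ι → MvPolynomial σ K)) : Prop :=
  ∀ v ∈ N, ∀ e, comp d e v ∈ N

theorem exists_homogeneous_generators [Finite σ] {ι : Type*} [Finite ι] (d : ι → ℤ)
    (N : Submodule (MvPolynomial σ K) (ι → MvPolynomial σ K)) (hN : IsGradedSubmodule d N) :
    ∃ (b : ℕ) (g : Fin b → ι → MvPolynomial σ K) (d' : Fin b → ℤ),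
      (∀ k, IsHomogeneousVec d (d' k) (g k)) ∧
        Submodule.span (MvPolynomial σ K) (Set.range g) = N := by
  classical
  let A : Set (ι → MvPolynomial σ K) := {v | v ∈ N ∧ ∃ e, IsHomogeneousVec d e v}
  have hA : Submodule.span (MvPolynomial σ K) A = N := by
    apply le_antisymm
    · exact Submodule.span_le.2 fun v hv => hv.1
    · intro v hv
      obtain ⟨T, hT⟩ := exists_sum_comp d v
      rw [hT]
      exact Submodule.sum_mem _ fun e _ =>
        Submodule.subset_span ⟨hN v hv e, e, isHomogeneousVec_comp d e v⟩
  have hfg : (Submodule.span (MvPolynomial σ K) A).FG := IsNoetherian.noetherian _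
  obtain ⟨t, htA, ht⟩ := (Submodule.fg_span_iff_fg_span_finset_subset A).1 hfg
  have hd : ∀ x : t, ∃ e, IsHomogeneousVec d e (x : ι → MvPolynomial σ K) :=
    fun x => (htA x.2).2
  choose e he using hd
  refine ⟨t.card, fun k => (t.equivFin.symm k : t), fun k => e (t.equivFin.symm k),
    fun k => he _, ?_⟩
  rw [← hA, ht]
  congr 1
  ext v
  constructor
  · rintro ⟨k, rfl⟩
    exact (t.equivFin.symm k).2
  · intro hv
    exact ⟨t.equivFin ⟨v, hv⟩, by simp⟩

theorem exists_minimal_cover [Finite σ] {ι : Type*} [Finite ι] (d : ι → ℤ)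
    (N : Submodule (MvPolynomial σ K) (ι → MvPolynomial σ K)) (hN : IsGradedSubmodule d N) :
    ∃ (b : ℕ) (d' : Fin b → ℤ)
      (φ : (Fin b → MvPolynomial σ K) →ₗ[MvPolynomial σ K] (ι → MvPolynomial σ K)),
      (∀ k, IsHomogeneousVec d (d' k) (φ (Pi.single k 1))) ∧
      LinearMap.range φ = N ∧
      (∀ v ∈ LinearMap.ker φ, ∀ l, constantCoeff (v l) = 0) ∧
      IsGradedSubmodule d' (LinearMap.ker φ) := by
  classical
  have hex := exists_homogeneous_generators d N hN
  obtain ⟨g, d', hg, hspan⟩ := Nat.find_spec hex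
  have hmin : ∀ m < Nat.find hex, ¬ _ := fun m hm => Nat.find_min hex hm
  generalize Nat.find hex = b at g d' hg hspan hmin
  have hφ : ∀ v : Fin b → MvPolynomial σ K,
      Fintype.linearCombination (MvPolynomial σ K) g v = ∑ k, v k • g k := fun v => rfl
  have hgr : IsGradedSubmodule d'
      (LinearMap.ker (Fintype.linearCombination (MvPolynomial σ K) g)) := by
    intro v hv e
    rw [LinearMap.mem_ker, hφ] at hv ⊢
    funext l
    have h1 := congrArg (hc (e - d l)) (congrFun hv l)
    rw [Finset.sum_apply, hc_sum, Pi.zero_apply, hc_zero] at h1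
    rw [Finset.sum_apply, Pi.zero_apply, ← h1]
    refine Finset.sum_congr rfl fun k _ => ?_
    rw [Pi.smul_apply, Pi.smul_apply, smul_eq_mul, smul_eq_mul,
      hc_mul (e - d l) (d' k - d l) (v k) (g k l)
        (fun μ hμ => by have := hg k l μ hμ; omega), comp]
    congr 2
    ring
  refine ⟨b, d', Fintype.linearCombination (MvPolynomial σ K) g, ?_, ?_, ?_, hgr⟩
  · intro k
    rw [Fintype.linearCombination_apply_single, one_smul]
    exact hg k
  · rw [Fintype.range_linearCombination, hspan]
  · intro v hv k
    by_contra hne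
    have h1 := hgr v hv (d' k)
    rw [LinearMap.mem_ker, hφ] at h1
    have hk : comp d' (d' k) v k = C (constantCoeff (v k)) := by
      rw [comp, sub_self, hc_zero_eq_C]
    generalize comp d' (d' k) v = w at h1 hk
    have hbpos : 0 < b := k.pos
    obtain ⟨m, hm⟩ : ∃ m, b = m + 1 := ⟨b - 1, by omega⟩
    subst hm
    refine hmin m (Nat.lt_succ_self m) ⟨fun j => g (k.succAbove j),
      fun j => d' (k.succAbove j), fun j => hg _, ?_⟩
    rw [← hspan]
    apply le_antisymm
    · exact Submodule.span_mono (by rintro _ ⟨j, rfl⟩; exact ⟨_, rfl⟩)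
    · rw [Submodule.span_le]
      have hin : ∀ j, g (k.succAbove j) ∈ Submodule.span (MvPolynomial σ K)
          (Set.range fun j => g (k.succAbove j)) := fun j => Submodule.subset_span ⟨j, rfl⟩
      have hgk : g k ∈ Submodule.span (MvPolynomial σ K)
          (Set.range fun j => g (k.succAbove j)) := by
        rw [Fin.sum_univ_succAbove _ k, hk] at h1
        have h2 : g k = (C (constantCoeff (v k))⁻¹ : MvPolynomial σ K) •
            (-∑ j, w (k.succAbove j) • g (k.succAbove j)) := by
          rw [← eq_neg_of_add_eq_zero_left h1, smul_smul, ← C_mul, inv_mul_cancel₀ hne, C_1,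
            one_smul]
        rw [h2]
        exact Submodule.smul_mem _ _ (Submodule.neg_mem _
          (Submodule.sum_mem _ fun j _ => Submodule.smul_mem _ _ (hin j)))
      rintro _ ⟨j, rfl⟩
      by_cases hj : j = k
      · subst hj; exact hgk
      · obtain ⟨i, rfl⟩ := Fin.exists_succAbove_eq hj
        exact hin i

/-- A graded submodule of a graded free module of finite rank (used to build resolutions). -/
structure Stage (σ K : Type*) [Field K] where
  b : ℕ
  d : Fin b → ℤ
  N : Submodule (MvPolynomial σ K) (Fin b → MvPolynomial σ K)
  graded : IsGradedSubmodule d N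

/-- A homogeneous ideal of a polynomial ring in finitely many variables has a minimal graded free
resolution. -/
theorem nonempty_minimalGradedFreeResolution [Finite σ] (I : Ideal (MvPolynomial σ K))
    (hI : I.IsHomogeneous (homogeneousSubmodule σ K)) :
    Nonempty (MinimalGradedFreeResolution I) := by
  classical
  have hstep : ∀ T : Stage σ K, _ := fun T => exists_minimal_cover T.d T.N T.graded
  choose b d φ hhom hrange hker hgr using hstep
  let N₀ : Submodule (MvPolynomial σ K) (Unit → MvPolynomial σ K) :=
    Submodule.comap (LinearMap.proj ()) I
  have hN₀ : IsGradedSubmodule (fun _ : Unit => (0 : ℤ)) N₀ := by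
    intro v hv e
    change hc (e - 0) (v ()) ∈ I
    have hv' : v () ∈ I := hv
    rw [sub_zero, hc]
    split_ifs
    · have := hI e.toNat hv'
      rwa [← decomposition.decompose'_apply]
    · exact I.zero_mem
  obtain ⟨b₀, d₀, φ₀, hhom₀, hrange₀, hker₀, hgr₀⟩ := exists_minimal_cover _ N₀ hN₀
  let st : ℕ → Stage σ K := fun n => Nat.rec ⟨b₀, d₀, LinearMap.ker φ₀, hgr₀⟩
    (fun _ T => ⟨b T, d T, LinearMap.ker (φ T), hgr T⟩) n
  have hmin : ∀ i, ∀ v ∈ (st i).N, ∀ l, constantCoeff (v l) = 0 := by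
    intro i
    cases i with
    | zero => exact hker₀
    | succ i => exact hker (st i)
  refine ⟨{ rank := fun i => (st i).b, deg := fun i => (st i).d,
            aug := (LinearMap.proj ()).comp φ₀, diff := fun i => φ (st i),
            aug_homogeneous := ?_, diff_homogeneous := ?_, range_aug := ?_, exact_zero := ?_,
            exact_succ := ?_, minimal := ?_ }⟩
  · intro k μ hμ
    have := hhom₀ k () μ hμ
    rwa [add_zero] at this
  · intro i k
    exact hhom (st i) k
  · rw [LinearMap.range_comp, hrange₀]
    ext p
    constructor
    · rintro ⟨v, hv, rfl⟩
      exact hv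
    · intro hp
      exact ⟨fun _ => p, hp, rfl⟩
  · rw [LinearMap.exact_iff]
    refine Eq.trans ?_ (hrange (st 0)).symm
    ext v
    rw [LinearMap.mem_ker, LinearMap.comp_apply]
    constructor
    · intro h
      exact LinearMap.mem_ker.2 (funext fun _ => h)
    · intro h
      exact congrFun (LinearMap.mem_ker.1 h) ()
  · intro i
    rw [LinearMap.exact_iff]
    exact (hrange (st (i + 1))).symm
  · intro i v l
    refine hmin i _ ?_ l
    rw [← hrange (st i)]
    exact LinearMap.mem_range_self _ _

/-! ### Graded Betti numbers and Castelnuovo–Mumford regularity -/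

/-- The graded Betti number `β_{i,j}(I)` of a homogeneous ideal `I`: the number of summands `S(-j)`
in homological degree `i` of the minimal graded free resolution of `I`. -/
def gradedBetti [Finite σ] (I : Ideal (MvPolynomial σ K))
    (hI : I.IsHomogeneous (homogeneousSubmodule σ K)) (i : ℕ) (j : ℤ) : ℕ :=
  Nat.card {k : Fin ((nonempty_minimalGradedFreeResolution I hI).some.rank i) //
    (nonempty_minimalGradedFreeResolution I hI).some.deg i k = j}

/-- The Castelnuovo–Mumford regularity `reg(I) = max {j - i | β_{i,j}(I) ≠ 0}` of a homogeneous
ideal `I`, as a supremum in the extended real line (so that it is `⊥` for `I = 0`). -/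
def regularity [Finite σ] (I : Ideal (MvPolynomial σ K))
    (hI : I.IsHomogeneous (homogeneousSubmodule σ K)) : EReal :=
  sSup {r : EReal | ∃ (i : ℕ) (j : ℤ), gradedBetti I hI i j ≠ 0 ∧ r = ((j - i : ℤ) : ℝ)}

/-! ### Edge ideals, squarefree powers, matching numbers -/

/-- The edge ideal `I(G) = (x_u x_v : uv ∈ E(G))` in the polynomial ring over `K` whose variables
are the vertices of `G`. -/
def edgeIdeal (K : Type*) [Field K] {V : Type*} (G : SimpleGraph V) : Ideal (MvPolynomial V K) :=
  Ideal.span {p | ∃ u v, G.Adj u v ∧ p = X u * X v}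

/-- The `s`-th squarefree power `I^[s]` of `I`: the ideal generated by the squarefree monomials
that belong to `I ^ s`. -/
def squarefreePower (I : Ideal (MvPolynomial σ K)) (s : ℕ) : Ideal (MvPolynomial σ K) :=
  Ideal.span {p | p ∈ I ^ s ∧ ∃ A : Finset σ, p = ∏ a ∈ A, X a}

theorem squarefreePower_isHomogeneous (I : Ideal (MvPolynomial σ K)) (s : ℕ) :
    (squarefreePower I s).IsHomogeneous (homogeneousSubmodule σ K) := by
  apply Ideal.homogeneous_span
  rintro p ⟨-, A, rfl⟩
  refine ⟨∑ a ∈ A, 1, ?_⟩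
  exact IsHomogeneous.prod A _ _ fun a _ => isHomogeneous_X K a

/-- The matching number of a (finite) graph: the largest number of edges of a matching. -/
def matchingNumber {V : Type*} (G : SimpleGraph V) : ℕ :=
  sSup {m | ∃ M : G.Subgraph, M.IsMatching ∧ M.edgeSet.ncard = m}

end GradedRes

end

noncomputable section

namespace GradedRes

open MvPolynomial Matrix

variable {σ K : Type*} [Field K]

attribute [local instance] MvPolynomial.gradedAlgebra

/-! ### Homogeneous elements with integer degrees -/

/-! Regularity is measured by Koszul homology: a cycle in homological degree `i` with coefficients
of degree `m` in `I` represents a class of Tor_i(I, K) in degree `i + m`. So reg I ≤ r follows once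
cycles with coefficients in `I` of degree above `r` bound in `I`.
`MinimalGradedFreeResolution.deg_le` carries this to the minimal resolution, one syzygy module at a
time.

For a squarefree monomial u of degree d, reg I ≤ max(reg(I : u) + d, reg(I + (u)))
(`RegularityLE.of_colon`). The ideal I(G)^[s] is generated by the monomials of the vertex sets of
s-matchings and contains I(G)^[s+1]. Starting from it, delete these generators in increasing colex
order, keeping I(G)^[s+1] throughout. When x_B is deleted, the colon of the remaining ideal by x_B
is generated by variables and quadrics outside B (`exists_small_subset`). This rests on the exchange
property of matchable sets (`Matchable.exchange`), proved by following an alternating path.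

An ideal generated by variables and edges on n - 2s vertices has regularity at most ⌊(n - 2s)/2⌋ + 1
(`regularityLE_of_card_le_two`). Adding |B| = 2s gives s + 1 + ⌊n/2⌋, hence reg I(G)^[s+1] ≤ max(reg
I(G)^[s], s + 1 + ⌊n/2⌋). Induction from I(G)^[0] = S finishes. -/

/-- Every monomial of `p` has degree `m`. -/
def HasDegree (m : ℤ) (p : MvPolynomial σ K) : Prop :=
  ∀ μ ∈ p.support, (μ.degree : ℤ) = m

theorem hasDegree_iff_hc {m : ℤ} {p : MvPolynomial σ K} : HasDegree m p ↔ hc m p = p := by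
  constructor
  · intro h
    ext μ
    rw [coeff_hc]
    split_ifs with h1
    · rfl
    · by_contra h2
      exact h1 (h μ (mem_support_iff.2 (Ne.symm h2)))
  · intro h μ hμ
    rw [mem_support_iff, ← h, coeff_hc] at hμ
    by_contra h1
    exact hμ (if_neg h1)

theorem hasDegree_hc (m : ℤ) (p : MvPolynomial σ K) : HasDegree m (hc m p) := by
  intro μ hμ
  rw [mem_support_iff, coeff_hc] at hμ
  by_contra h
  exact hμ (if_neg h)

theorem HasDegree.mul {a b : ℤ} {p q : MvPolynomial σ K} (hp : HasDegree a p)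
    (hq : HasDegree b q) : HasDegree (a + b) (p * q) := by
  rw [hasDegree_iff_hc, hc_mul _ b p q hq, add_sub_cancel_right, hasDegree_iff_hc.1 hp]

theorem HasDegree.sum {ι : Type*} {m : ℤ} {s : Finset ι} {f : ι → MvPolynomial σ K}
    (h : ∀ i ∈ s, HasDegree m (f i)) : HasDegree m (∑ i ∈ s, f i) := by
  rw [hasDegree_iff_hc, hc_sum]
  exact Finset.sum_congr rfl fun i hi => hasDegree_iff_hc.1 (h i hi)

theorem hc_add (m : ℤ) (p q : MvPolynomial σ K) : hc m (p + q) = hc m p + hc m q := by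
  ext μ
  simp only [coeff_hc, coeff_add]
  split_ifs <;> simp

theorem HasDegree.add {m : ℤ} {p q : MvPolynomial σ K} (hp : HasDegree m p)
    (hq : HasDegree m q) : HasDegree m (p + q) := by
  rw [hasDegree_iff_hc, hc_add, hasDegree_iff_hc.1 hp, hasDegree_iff_hc.1 hq]

theorem HasDegree.sub {m : ℤ} {p q : MvPolynomial σ K} (hp : HasDegree m p)
    (hq : HasDegree m q) : HasDegree m (p - q) := by
  rw [sub_eq_add_neg]
  exact hp.add fun μ hμ => hq μ (by simpa using hμ)

theorem hasDegree_X (a : σ) : HasDegree 1 (X a : MvPolynomial σ K) := by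
  intro μ hμ
  have := (isHomogeneous_X K a) (mem_support_iff.1 hμ)
  rw [Finsupp.degree_eq_weight_one]
  exact_mod_cast this

theorem HasDegree.constantCoeff_eq_zero {m : ℤ} (hm : m ≠ 0) {p : MvPolynomial σ K}
    (h : HasDegree m p) : constantCoeff p = 0 := by
  by_contra hne
  have := h 0 (by simpa [constantCoeff_eq] using hne)
  exact hm (by simpa using this.symm)

/-! ### The Koszul complex -/

/-- The total Koszul complex of the variables in `T`: a square-zero matrix of linear forms whose
homology is concentrated at the basis element `o`, where it is `S / (X_a : a ∈ T)`. -/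
structure KoszulMatrix (K : Type*) [Field K] {σ : Type*} (T : Set σ) where
  ι : Type
  [fintype : Fintype ι]
  [decEq : DecidableEq ι]
  D : Matrix ι ι (MvPolynomial σ K)
  o : ι
  sq_zero : D * D = 0
  hasDegree : ∀ i j, HasDegree 1 (D i j)
  mem_span : ∀ i j, D i j ∈ Ideal.span (X '' T : Set (MvPolynomial σ K))
  col_o : ∀ i, D i o = 0
  acyclic : ∀ z, D *ᵥ z = 0 → z o ∈ Ideal.span (X '' T : Set (MvPolynomial σ K)) →
    ∃ f, D *ᵥ f = z

attribute [instance] KoszulMatrix.fintype KoszulMatrix.decEq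

/-- A variable outside `T` is a nonzerodivisor modulo the variables in `T`; this is the
regular-sequence input for the Koszul complex. -/
theorem mem_span_X_image_of_X_mul {T : Set σ} {x : σ} (hx : x ∉ T) {p : MvPolynomial σ K}
    (h : X x * p ∈ Ideal.span (X '' T : Set (MvPolynomial σ K))) :
    p ∈ Ideal.span (X '' T : Set (MvPolynomial σ K)) := by
  classical
  rw [mem_ideal_span_X_image] at h ⊢
  intro μ hμ
  obtain ⟨a, ha, h1⟩ := h (Finsupp.single x 1 + μ) (by
    rw [mem_support_iff, coeff_X_mul]
    exact mem_support_iff.1 hμ)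
  refine ⟨a, ha, ?_⟩
  have hne : x ≠ a := fun h => hx (h ▸ ha)
  simpa [Finsupp.single_apply, hne] using h1

/-- Adding a variable `x` replaces the complex by the mapping cone of multiplication by `x`, which
is the block matrix below. -/
theorem nonempty_koszulMatrix (T : Finset σ) : Nonempty (KoszulMatrix K (T : Set σ)) := by
  classical
  induction T using Finset.induction_on with
  | empty =>
    refine ⟨{ ι := Unit, D := 0, o := (), sq_zero := by simp, hasDegree := ?_,
              mem_span := by simp, col_o := by simp, acyclic := ?_ }⟩
    · intro i j μ hμ
      simp at hμ
    · intro z _ hz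
      refine ⟨0, ?_⟩
      have h0 : z () = 0 := by simpa using hz
      funext i
      simpa using h0.symm
  | insert x T hx ih =>
    obtain ⟨C⟩ := ih
    have hle : Ideal.span (X '' (T : Set σ) : Set (MvPolynomial σ K)) ≤
        Ideal.span (X '' ((insert x T : Finset σ) : Set σ) : Set (MvPolynomial σ K)) :=
      Ideal.span_mono (Set.image_mono (by simp))
    have hxm : (X x : MvPolynomial σ K) ∈
        Ideal.span (X '' ((insert x T : Finset σ) : Set σ) : Set (MvPolynomial σ K)) :=
      Ideal.subset_span (Set.mem_image_of_mem X (by simp))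
    refine ⟨{ ι := C.ι ⊕ C.ι, D := fromBlocks C.D ((X x : MvPolynomial σ K) • 1) 0 (-C.D), o := Sum.inl C.o,
              sq_zero := ?_, hasDegree := ?_, mem_span := ?_, col_o := ?_, acyclic := ?_ }⟩
    · rw [fromBlocks_multiply]
      simp [C.sq_zero]
    · have h0 : HasDegree 1 (0 : MvPolynomial σ K) := by
        intro μ hμ
        simp at hμ
      rintro (i | i) (j | j)
      · exact C.hasDegree i j
      · rw [fromBlocks_apply₁₂, Matrix.smul_apply, one_apply, smul_eq_mul, mul_ite, mul_one, mul_zero]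
        split_ifs
        · exact hasDegree_X x
        · exact h0
      · exact h0
      · intro μ hμ
        apply C.hasDegree i j μ
        simpa using hμ
    · rintro (i | i) (j | j)
      · exact hle (C.mem_span i j)
      · rw [fromBlocks_apply₁₂, Matrix.smul_apply, smul_eq_mul]
        exact Ideal.mul_mem_right _ _ hxm
      · exact Ideal.zero_mem _
      · exact hle (neg_mem (C.mem_span i j))
    · rintro (i | i)
      · exact C.col_o i
      · rfl
    · intro z hz hzo
      rw [fromBlocks_mulVec] at hz
      set z₁ := z ∘ Sum.inl with hz₁
      set z₂ := z ∘ Sum.inr with hz₂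
      have e1 : C.D *ᵥ z₁ + (X x : MvPolynomial σ K) • z₂ = 0 := by
        funext i
        simpa [smul_mulVec] using congrFun hz (Sum.inl i)
      have e2 : C.D *ᵥ z₂ = 0 := by
        funext i
        simpa [neg_mulVec] using congrFun hz (Sum.inr i)
      have h2 : z₂ C.o ∈ Ideal.span (X '' (T : Set σ) : Set (MvPolynomial σ K)) := by
        apply mem_span_X_image_of_X_mul (x := x) (by simpa using hx)
        have h3 : X x * z₂ C.o = -(C.D *ᵥ z₁) C.o := by
          have := congrFun e1 C.o
          simp only [Pi.add_apply, Pi.smul_apply, smul_eq_mul, Pi.zero_apply] at this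
          rw [eq_neg_iff_add_eq_zero, add_comm]
          exact this
        rw [h3, neg_mem_iff]
        exact Ideal.sum_mem _ fun j _ => Ideal.mul_mem_right _ _ (C.mem_span _ _)
      obtain ⟨w, hw⟩ := C.acyclic z₂ e2 h2
      have hy : z₁ C.o + X x * w C.o ∈
          Ideal.span (X '' ((insert x T : Finset σ) : Set σ) : Set (MvPolynomial σ K)) :=
        Ideal.add_mem _ hzo (Ideal.mul_mem_right _ _ hxm)
      -- The multiple `q` of `x` in the `o`-component is subtracted off, so that the rest lies in
      -- the ideal of `T` and acyclicity of `C` applies; `q` placed at `o` is a cycle because column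
      -- `o` vanishes.
      rw [Finset.coe_insert, Set.image_insert_eq, Ideal.mem_span_insert] at hy
      obtain ⟨q, p, hp, hqp⟩ := hy
      have hq0 : C.D *ᵥ (Pi.single C.o q) = 0 := by
        funext i
        simp [C.col_o]
      obtain ⟨v, hv⟩ := C.acyclic (z₁ + (X x : MvPolynomial σ K) • w
          - (X x : MvPolynomial σ K) • Pi.single C.o q) (by
        rw [mulVec_sub, mulVec_add, mulVec_smul, mulVec_smul, hw, e1, hq0, smul_zero, sub_zero])
        (by
          simp only [Pi.sub_apply, Pi.add_apply, Pi.smul_apply, smul_eq_mul, Pi.single_eq_same]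
          rw [hqp, mul_comm q, add_sub_cancel_left]
          exact hp)
      refine ⟨Sum.elim v (Pi.single C.o q - w), ?_⟩
      rw [fromBlocks_mulVec]
      funext i
      rcases i with i | i
      · simp only [Sum.elim_comp_inl, Sum.elim_comp_inr, Sum.elim_inl, hv, smul_mulVec,
          one_mulVec, Pi.add_apply, Pi.sub_apply, Pi.smul_apply, smul_sub]
        simp [hz₁]
      · simp only [Sum.elim_comp_inl, Sum.elim_comp_inr, Sum.elim_inr, zero_mulVec, neg_mulVec,
          mulVec_sub, hq0, hw]
        simp [hz₂]

/-! ### Vanishing of Koszul homology in large internal degrees -/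

section KoszulVanishing

variable {M : Type*} [AddCommGroup M] [Module (MvPolynomial σ K) M] {T : Set σ}

/-- The Koszul differential on chains with coefficients in `M`. -/
def KoszulMatrix.bd (C : KoszulMatrix K T) (z : C.ι → M) (i : C.ι) : M := ∑ j, C.D i j • z j

theorem KoszulMatrix.bd_add (C : KoszulMatrix K T) (z w : C.ι → M) :
    C.bd (z + w) = C.bd z + C.bd w := by
  funext i
  simp [bd, Finset.sum_add_distrib]

theorem KoszulMatrix.bd_sub (C : KoszulMatrix K T) (z w : C.ι → M) :
    C.bd (z - w) = C.bd z - C.bd w := by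
  funext i
  simp [bd, smul_sub]

theorem KoszulMatrix.bd_smul (C : KoszulMatrix K T) (p : MvPolynomial σ K) (z : C.ι → M) :
    C.bd (p • z) = p • C.bd z := by
  funext i
  simp only [bd, Pi.smul_apply, Finset.smul_sum]
  exact Finset.sum_congr rfl fun j _ => smul_comm _ _ _

theorem KoszulMatrix.bd_bd (C : KoszulMatrix K T) (z : C.ι → M) : C.bd (C.bd z) = 0 := by
  funext i
  simp only [bd, Finset.smul_sum, smul_smul]
  rw [Finset.sum_comm]
  refine Finset.sum_eq_zero fun k _ => ?_
  rw [← Finset.sum_smul]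
  have := congrFun (congrFun C.sq_zero i) k
  rw [mul_apply] at this
  rw [this, Matrix.zero_apply, zero_smul]

theorem KoszulMatrix.map_bd {M' : Type*} [AddCommGroup M'] [Module (MvPolynomial σ K) M']
    (C : KoszulMatrix K T) (φ : M →ₗ[MvPolynomial σ K] M') (z : C.ι → M) (i : C.ι) :
    φ (C.bd z i) = C.bd (fun j => φ (z j)) i := by
  simp [bd]

theorem KoszulMatrix.bd_mem (C : KoszulMatrix K T) {N : Submodule (MvPolynomial σ K) M}
    {z : C.ι → M} (hz : ∀ i, z i ∈ N) (i : C.ι) : C.bd z i ∈ N :=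
  N.sum_mem fun j _ => N.smul_mem _ (hz j)

theorem KoszulMatrix.hc_bd (C : KoszulMatrix K T) (m : ℤ) (z : C.ι → MvPolynomial σ K)
    (i : C.ι) : hc m (C.bd z i) = C.bd (fun j => hc (m - 1) (z j)) i := by
  simp only [bd, hc_sum, smul_eq_mul]
  refine Finset.sum_congr rfl fun j _ => ?_
  rw [mul_comm, hc_mul m 1 _ _ (C.hasDegree i j), mul_comm]

theorem KoszulMatrix.hasDegree_bd (C : KoszulMatrix K T) {m : ℤ} {z : C.ι → MvPolynomial σ K}
    (hz : ∀ i, HasDegree m (z i)) (i : C.ι) : HasDegree (m + 1) (C.bd z i) := by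
  refine HasDegree.sum fun j _ => ?_
  rw [add_comm]
  exact (C.hasDegree i j).mul (hz j)

/-- Koszul cycles with values in `N` that are homogeneous of internal degree larger than `r` are
boundaries. Here `H m` is the predicate of being homogeneous of degree `m` in `M`. -/
def KoszulMatrix.RegularityLE (C : KoszulMatrix K T) (H : ℤ → M → Prop)
    (N : Submodule (MvPolynomial σ K) M) (r : ℤ) : Prop :=
  ∀ m, r < m → ∀ z : C.ι → M, (∀ i, z i ∈ N) → (∀ i, H m (z i)) → C.bd z = 0 →
    ∃ c : C.ι → M, (∀ i, c i ∈ N) ∧ C.bd c = z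

theorem KoszulMatrix.RegularityLE.mono {C : KoszulMatrix K T} {H : ℤ → M → Prop}
    {N : Submodule (MvPolynomial σ K) M} {r r' : ℤ} (h : C.RegularityLE H N r) (hr : r ≤ r') :
    C.RegularityLE H N r' :=
  fun m hm => h m (hr.trans_lt hm)

end KoszulVanishing

/-! ### From Koszul vanishing to the degrees in a minimal resolution. -/

theorem mem_span_X_univ {p : MvPolynomial σ K} (hp : constantCoeff p = 0) :
    p ∈ Ideal.span (X '' Set.univ : Set (MvPolynomial σ K)) := by
  rw [mem_ideal_span_X_image]
  intro μ hμ
  have hne : μ ≠ 0 := by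
    rintro rfl
    exact mem_support_iff.1 hμ (by rwa [← constantCoeff_eq])
  obtain ⟨a, ha⟩ := Finsupp.ne_iff.1 hne
  exact ⟨a, Set.mem_univ _, ha⟩

section MinimalCover

variable {M : Type*} [AddCommGroup M] [Module (MvPolynomial σ K) M]
  {κ : Type*} {d : κ → ℤ} {H : ℤ → M → Prop}
  {φ : (κ → MvPolynomial σ K) →ₗ[MvPolynomial σ K] M} {r : ℤ}

/-- The connecting homomorphism made explicit. By minimality a cycle in the kernel has coefficients
in 𝔪F, so it bounds a chain `g` in the free module; `φ g` is then a cycle of degree one less, bounds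
some `φ b`, and `g - ∂b` is a chain in the kernel with the same boundary. -/
theorem KoszulMatrix.RegularityLE.ker {C : KoszulMatrix K (Set.univ : Set σ)}
    (h : C.RegularityLE H (LinearMap.range φ) r)
    (hφ : ∀ e v, IsHomogeneousVec d e v → H e (φ v))
    (hmin : ∀ v ∈ LinearMap.ker φ, ∀ l, constantCoeff (v l) = 0) :
    C.RegularityLE (IsHomogeneousVec d) (LinearMap.ker φ) (r + 1) := by
  intro m hm z hz hzd hz0
  have hex : ∀ l, ∃ f, C.D *ᵥ f = fun i => z i l := by
    intro l
    refine C.acyclic _ ?_ (mem_span_X_univ (hmin _ (hz _) l))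
    funext i
    have := congrFun (congrFun hz0 i) l
    simpa [bd, mulVec, dotProduct] using this
  choose f hf using hex
  -- Acyclicity gives no homogeneity, so the component of degree `m - 1` is extracted; the
  -- differential is linear in the variables.
  let g : C.ι → κ → MvPolynomial σ K := fun i l => hc (m - 1 - d l) (f l i)
  have hg : C.bd g = z := by
    funext i l
    have h1 : C.bd g i l = C.bd (fun j => hc (m - d l - 1) (f l j)) i := by
      simp only [bd, Finset.sum_apply, Pi.smul_apply]
      refine Finset.sum_congr rfl fun j _ => ?_
      change _ • hc (m - 1 - d l) (f l j) = _
      rw [sub_right_comm]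
    rw [h1, ← C.hc_bd]
    have h2 : C.bd (f l) i = z i l := congrFun (hf l) i
    rw [h2]
    exact hasDegree_iff_hc.1 fun μ hμ => by have := hzd i l μ hμ; omega
  have hgd : ∀ i, IsHomogeneousVec d (m - 1) (g i) := by
    intro i l μ hμ
    have := hasDegree_hc (m - 1 - d l) (f l i) μ hμ
    omega
  obtain ⟨c, hc, hcb⟩ := h (m - 1) (by omega) (fun i => φ (g i)) (fun i => ⟨_, rfl⟩)
    (fun i => hφ _ _ (hgd i)) (by
      funext i
      rw [← C.map_bd, hg]
      exact hz i)
  choose b hb using hc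
  refine ⟨g - C.bd b, fun i => ?_, ?_⟩
  · rw [LinearMap.mem_ker, Pi.sub_apply, map_sub, C.map_bd, sub_eq_zero]
    simp only [hb]
    exact (congrFun hcb i).symm
  · rw [C.bd_sub, C.bd_bd, sub_zero, hg]

/-- A generator of degree above `r`, placed at `o`, is a cycle and hence a boundary. It therefore
lies in 𝔪 times the module, giving a kernel element with constant coefficient 1 at `k`. -/
theorem KoszulMatrix.RegularityLE.deg_le [DecidableEq κ] {C : KoszulMatrix K (Set.univ : Set σ)}
    (h : C.RegularityLE H (LinearMap.range φ) r)
    (hH : ∀ e, H e 0)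
    (hφ : ∀ k, H (d k) (φ (Pi.single k 1)))
    (hmin : ∀ v ∈ LinearMap.ker φ, ∀ l, constantCoeff (v l) = 0) (k : κ) : d k ≤ r := by
  by_contra! hlt
  obtain ⟨c, hc, hcb⟩ := h (d k) hlt (Pi.single C.o (φ (Pi.single k 1)))
    (by
      intro i
      by_cases hi : i = C.o
      · subst hi
        rw [Pi.single_eq_same]
        exact ⟨_, rfl⟩
      · rw [Pi.single_eq_of_ne hi]
        exact zero_mem _)
    (by
      intro i
      by_cases hi : i = C.o
      · subst hi
        rw [Pi.single_eq_same]
        exact hφ k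
      · rw [Pi.single_eq_of_ne hi]
        exact hH _)
    (by
      funext i
      refine Finset.sum_eq_zero fun j _ => ?_
      by_cases hj : j = C.o
      · rw [hj, C.col_o, zero_smul]
      · rw [Pi.single_eq_of_ne hj, smul_zero])
  choose b hb using hc
  have h1 := congrFun hcb C.o
  rw [Pi.single_eq_same] at h1
  have h2 : (Pi.single k 1 - C.bd b C.o : κ → MvPolynomial σ K) ∈ LinearMap.ker φ := by
    rw [LinearMap.mem_ker, map_sub, C.map_bd, sub_eq_zero]
    simp only [hb]
    exact h1.symm
  have h3 := hmin _ h2 k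
  simp [bd, (C.hasDegree _ _).constantCoeff_eq_zero one_ne_zero] at h3

end MinimalCover

theorem MinimalGradedFreeResolution.deg_le {I : Ideal (MvPolynomial σ K)}
    (F : MinimalGradedFreeResolution I) {C : KoszulMatrix K (Set.univ : Set σ)} {r : ℤ}
    (h : C.RegularityLE HasDegree I r) (i : ℕ) (k : Fin (F.rank i)) : F.deg i k ≤ r + i := by
  classical
  -- The shift `a` lets one statement serve both the augmentation (`a = 0`) and the coordinate `l`
  -- of a differential (`a = -F.deg i l`).
  have hmap : ∀ {n : ℕ} (d : Fin n → ℤ)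
      (ψ : (Fin n → MvPolynomial σ K) →ₗ[MvPolynomial σ K] MvPolynomial σ K) (a : ℤ)
      (_ : ∀ k, HasDegree (d k + a) (ψ (Pi.single k 1))) (e : ℤ) (v : Fin n → MvPolynomial σ K),
      IsHomogeneousVec d e v → HasDegree (e + a) (ψ v) := by
    intro n d ψ a hψ e v hv
    have : ψ v = ∑ k, v k * ψ (Pi.single k 1) := by
      conv_lhs => rw [pi_eq_sum_univ' v]
      simp [map_sum]
    rw [this]
    refine HasDegree.sum fun k _ => ?_
    have h1 : HasDegree (e - d k) (v k) := fun μ hμ => by have := hv k μ hμ; omega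
    have h2 := h1.mul (hψ k)
    convert h2 using 1
    ring
  have hdiff : ∀ i e v, IsHomogeneousVec (F.deg (i + 1)) e v →
      IsHomogeneousVec (F.deg i) e (F.diff i v) := by
    intro i e v hv l μ hμ
    have := hmap (F.deg (i + 1)) ((LinearMap.proj l).comp (F.diff i)) (-F.deg i l)
      (fun k ν hν => by have := F.diff_homogeneous i k l ν hν; omega) e v hv μ hμ
    omega
  have hker0 : LinearMap.ker F.aug = LinearMap.range (F.diff 0) :=
    LinearMap.exact_iff.1 F.exact_zero
  have hker : ∀ i, LinearMap.ker (F.diff i) = LinearMap.range (F.diff (i + 1)) := fun i =>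
    LinearMap.exact_iff.1 (F.exact_succ i)
  have hm0 : ∀ v ∈ LinearMap.ker F.aug, ∀ l, constantCoeff (v l) = 0 := by
    rw [hker0]
    rintro _ ⟨v, rfl⟩ l
    exact F.minimal 0 v l
  have hm : ∀ i, ∀ v ∈ LinearMap.ker (F.diff i), ∀ l, constantCoeff (v l) = 0 := by
    intro i
    rw [hker]
    rintro _ ⟨v, rfl⟩ l
    exact F.minimal _ v l
  have h0 : C.RegularityLE HasDegree (LinearMap.range F.aug) r := by
    rw [F.range_aug]
    exact h
  have hsucc : ∀ i : ℕ, C.RegularityLE (IsHomogeneousVec (F.deg i))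
      (LinearMap.range (F.diff i)) (r + (i + 1 : ℕ)) := by
    intro i
    induction i with
    | zero =>
      rw [← hker0]
      refine h0.ker (fun e v hv => ?_) hm0
      have := hmap (F.deg 0) F.aug 0 (fun k μ hμ => by
        have := F.aug_homogeneous k μ hμ; omega) e v hv
      rwa [add_zero] at this
    | succ i ih =>
      rw [← hker]
      have := ih.ker (hdiff i) (hm i)
      convert this using 1
      push_cast
      ring
  cases i with
  | zero =>
    have := h0.deg_le (d := F.deg 0) (fun e μ hμ => by simp at hμ)
      (fun k => F.aug_homogeneous k) hm0 k
    simpa using this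
  | succ i =>
    exact (hsucc i).deg_le (fun e l μ hμ => by simp at hμ) (F.diff_homogeneous i) (hm i) k

theorem regularity_le_of_regularityLE [Finite σ] {I : Ideal (MvPolynomial σ K)}
    (hI : I.IsHomogeneous (homogeneousSubmodule σ K))
    {C : KoszulMatrix K (Set.univ : Set σ)} {r : ℕ} (h : C.RegularityLE HasDegree I r) :
    regularity I hI ≤ (r : EReal) := by
  refine sSup_le ?_
  rintro _ ⟨i, j, hne, rfl⟩
  obtain ⟨⟨⟨k, hk⟩⟩, -⟩ := Nat.card_ne_zero.1 hne
  have := (nonempty_minimalGradedFreeResolution I hI).some.deg_le h i k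
  rw [hk] at this
  have h1 : ((j - i : ℤ) : ℝ) ≤ (r : ℝ) := by
    exact_mod_cast (by omega : j - i ≤ (r : ℤ))
  exact_mod_cast h1

end GradedRes
end

noncomputable section

namespace GradedRes

open MvPolynomial

variable {σ K : Type*} [Field K]

/-! ### Squarefree monomial ideals -/

/-- The squarefree monomial `∏_{a ∈ A} x_a`. -/
def sqfreeMonomial (K : Type*) [Field K] (A : Finset σ) : MvPolynomial σ K := ∏ a ∈ A, X a

/-- The exponent of the squarefree monomial with support `A`. -/
def sqfreeExponent (A : Finset σ) : σ →₀ ℕ := ∑ a ∈ A, Finsupp.single a 1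

theorem sqfreeExponent_apply [DecidableEq σ] (A : Finset σ) (a : σ) :
    sqfreeExponent A a = if a ∈ A then 1 else 0 := by
  simp [sqfreeExponent, Finsupp.finsetSum_apply, Finsupp.single_apply]

theorem sqfreeMonomial_eq (A : Finset σ) :
    sqfreeMonomial K A = monomial (sqfreeExponent A) 1 := by
  simp only [sqfreeMonomial, sqfreeExponent, monomial_sum_one]
  rfl

theorem sqfreeExponent_le_iff {A : Finset σ} {μ : σ →₀ ℕ} :
    sqfreeExponent A ≤ μ ↔ A ⊆ μ.support := by
  classical
  rw [Finsupp.le_def]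
  constructor
  · intro h a ha
    have := h a
    rw [sqfreeExponent_apply, if_pos ha] at this
    exact Finsupp.mem_support_iff.2 (by omega)
  · intro h a
    rw [sqfreeExponent_apply]
    split_ifs with ha
    · have := Finsupp.mem_support_iff.1 (h ha)
      omega
    · exact Nat.zero_le _

/-- The ideal generated by the squarefree monomials whose supports belong to `F`. -/
def sqfreeIdeal (K : Type*) [Field K] (F : Set (Finset σ)) : Ideal (MvPolynomial σ K) :=
  Ideal.span (sqfreeMonomial K '' F)

theorem mem_sqfreeIdeal {F : Set (Finset σ)} {p : MvPolynomial σ K} :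
    p ∈ sqfreeIdeal K F ↔ ∀ μ ∈ p.support, ∃ A ∈ F, A ⊆ μ.support := by
  have : sqfreeMonomial K '' F = (fun ν => monomial ν 1) '' (sqfreeExponent '' F) := by
    rw [Set.image_image]
    exact Set.image_congr fun A _ => sqfreeMonomial_eq A
  rw [sqfreeIdeal, this, mem_ideal_span_monomial_image]
  simp only [Set.exists_mem_image, sqfreeExponent_le_iff]

theorem sqfreeIdeal_le {F G : Set (Finset σ)} (h : ∀ A ∈ F, ∃ B ∈ G, B ⊆ A) :
    sqfreeIdeal K F ≤ sqfreeIdeal K G := by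
  intro p hp
  rw [mem_sqfreeIdeal] at hp ⊢
  intro μ hμ
  obtain ⟨A, hA, hAμ⟩ := hp μ hμ
  obtain ⟨B, hB, hBA⟩ := h A hA
  exact ⟨B, hB, hBA.trans hAμ⟩

theorem hc_mem_sqfreeIdeal {F : Set (Finset σ)} {p : MvPolynomial σ K}
    (hp : p ∈ sqfreeIdeal K F) (m : ℤ) : hc m p ∈ sqfreeIdeal K F := by
  rw [mem_sqfreeIdeal] at hp ⊢
  intro μ hμ
  refine hp μ ?_
  rw [mem_support_iff, coeff_hc] at hμ
  rw [mem_support_iff]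
  intro h
  simp [h] at hμ

/-- The colon by a squarefree monomial. Its generating family is closed under supersets, with the
sets `A \ U` already sufficient. -/
theorem sqfreeMonomial_mul_mem {F : Set (Finset σ)} [DecidableEq σ] {U : Finset σ}
    {p : MvPolynomial σ K} :
    sqfreeMonomial K U * p ∈ sqfreeIdeal K F ↔
      p ∈ sqfreeIdeal K {B | ∃ A ∈ F, A ⊆ B ∪ U} := by
  rw [sqfreeMonomial_eq, mem_sqfreeIdeal, mem_sqfreeIdeal]
  have hsupp : ∀ μ : σ →₀ ℕ, (sqfreeExponent U + μ).support = μ.support ∪ U := by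
    intro μ
    ext a
    simp only [Finsupp.mem_support_iff, Finsupp.add_apply, Finset.mem_union, sqfreeExponent_apply]
    split_ifs <;> simp_all
  constructor
  · intro h μ hμ
    obtain ⟨A, hA, hAμ⟩ := h (sqfreeExponent U + μ) (by
      rw [mem_support_iff, coeff_monomial_mul, one_mul]
      exact mem_support_iff.1 hμ)
    rw [hsupp] at hAμ
    exact ⟨_, ⟨A, hA, hAμ⟩, subset_rfl⟩
  · intro h μ hμ
    rw [mem_support_iff, coeff_monomial_mul', one_mul] at hμ
    have hle : sqfreeExponent U ≤ μ := by
      by_contra hn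
      exact hμ (if_neg hn)
    rw [if_pos hle] at hμ
    obtain ⟨B, ⟨A, hA, hAB⟩, hB⟩ := h _ (mem_support_iff.2 hμ)
    refine ⟨A, hA, hAB.trans ?_⟩
    rw [← add_tsub_cancel_of_le hle, hsupp]
    exact Finset.union_subset_union hB subset_rfl

theorem hasDegree_sqfreeMonomial (A : Finset σ) :
    HasDegree A.card (sqfreeMonomial K A) := by
  rw [sqfreeMonomial_eq]
  intro μ hμ
  rw [Finset.mem_singleton.1 (support_monomial_subset hμ), sqfreeExponent, map_sum]
  simp

theorem mem_sqfreeIdeal_insert {F : Set (Finset σ)} {U : Finset σ} {p : MvPolynomial σ K} :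
    p ∈ sqfreeIdeal K (insert U F) ↔
      ∃ l ∈ sqfreeIdeal K F, ∃ s, p = l + sqfreeMonomial K U * s := by
  rw [sqfreeIdeal, Set.image_insert_eq, Ideal.mem_span_insert]
  constructor
  · rintro ⟨a, z, hz, rfl⟩
    exact ⟨z, hz, a, by ring⟩
  · rintro ⟨l, hl, s, rfl⟩
    exact ⟨s, l, hl, by ring⟩

/-! ### Regularity of squarefree monomial ideals -/

variable {T : Set σ}

namespace KoszulMatrix

theorem bd_mul (C : KoszulMatrix K T) (p : MvPolynomial σ K) (z : C.ι → MvPolynomial σ K)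
    (i : C.ι) : C.bd (fun j => p * z j) i = p * C.bd z i :=
  congrFun (C.bd_smul p z) i

theorem bd_add_mul (C : KoszulMatrix K T) (p : MvPolynomial σ K)
    (z w : C.ι → MvPolynomial σ K) (i : C.ι) :
    C.bd (fun j => z j + p * w j) i = C.bd z i + p * C.bd w i := by
  rw [← C.bd_mul]
  exact congrFun (C.bd_add z fun j => p * w j) i

theorem exists_homogeneous_decomposition {F : Set (Finset σ)} {U : Finset σ} {ι : Type*}
    {m : ℤ} {c : ι → MvPolynomial σ K} (hF : ∀ i, c i ∈ sqfreeIdeal K (insert U F))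
    (hm : ∀ i, HasDegree m (c i)) :
    ∃ l s : ι → MvPolynomial σ K, (∀ i, l i ∈ sqfreeIdeal K F) ∧ (∀ i, HasDegree m (l i)) ∧
      (∀ i, HasDegree (m - U.card) (s i)) ∧ ∀ i, c i = l i + sqfreeMonomial K U * s i := by
  choose l hl s hs using fun i => mem_sqfreeIdeal_insert.1 (hF i)
  refine ⟨fun i => hc m (l i), fun i => hc (m - U.card) (s i),
    fun i => hc_mem_sqfreeIdeal (hl i) m, fun i => hasDegree_hc _ _, fun i => hasDegree_hc _ _,
    fun i => ?_⟩
  rw [← hasDegree_iff_hc.1 (hm i), hs i, hc_add, mul_comm,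
    hc_mul m U.card _ _ (hasDegree_sqfreeMonomial U), mul_comm]

/-- With I the ideal of `F` and u the monomial of `U`, write the chain bounded by `z` in I + (u) as
l + u s. Then u ∂s = z - ∂l lies in I, so ∂s is a cycle in I : u and equals ∂t for some t in I : u;
now l + u t lies in I and still bounds `z`. -/
theorem RegularityLE.of_colon [DecidableEq σ] {C : KoszulMatrix K T} {F : Set (Finset σ)}
    {U : Finset σ} {r : ℤ}
    (h₁ : C.RegularityLE HasDegree (sqfreeIdeal K {B | ∃ A ∈ F, A ⊆ B ∪ U}) (r - U.card))
    (h₂ : C.RegularityLE HasDegree (sqfreeIdeal K (insert U F)) r) :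
    C.RegularityLE HasDegree (sqfreeIdeal K F) r := by
  intro m hm z hz hzd hz0
  have hsub : sqfreeIdeal K F ≤ sqfreeIdeal K (insert U F) :=
    Ideal.span_mono (Set.image_mono (Set.subset_insert _ _))
  obtain ⟨c, hc, hcz⟩ := h₂ m hm z (fun i => hsub (hz i)) hzd hz0
  obtain ⟨l, s, hl, -, hs, hls⟩ := exists_homogeneous_decomposition (U := U) (m := m - 1)
    (c := fun i => GradedRes.hc (m - 1) (c i)) (fun i => hc_mem_sqfreeIdeal (hc i) _)
    (fun i => hasDegree_hc _ _)
  have hz' : ∀ i, z i = C.bd l i + sqfreeMonomial K U * C.bd s i := by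
    intro i
    rw [← C.bd_add_mul]
    simp only [← hls]
    rw [← C.hc_bd, hcz, hasDegree_iff_hc.1 (hzd i)]
  obtain ⟨t, ht, hts⟩ := h₁ (m - U.card) (by omega) (C.bd s)
    (fun i => sqfreeMonomial_mul_mem.1 (by
      rw [← add_sub_cancel_left (C.bd l i) (sqfreeMonomial K U * C.bd s i), ← hz']
      exact sub_mem (hz i) (C.bd_mem hl i)))
    (fun i => by
      have := C.hasDegree_bd hs i
      convert this using 1
      ring)
    (C.bd_bd s)
  refine ⟨fun i => l i + sqfreeMonomial K U * t i,
    fun i => add_mem (hl i) (sqfreeMonomial_mul_mem.2 (ht i)), ?_⟩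
  funext i
  rw [C.bd_add_mul, hts, hz']

theorem regularityLE_top (C : KoszulMatrix K (Set.univ : Set σ)) :
    C.RegularityLE HasDegree (⊤ : Ideal (MvPolynomial σ K)) 0 := by
  intro m hm z _ hzd hz0
  obtain ⟨f, hf⟩ := C.acyclic z hz0
    (mem_span_X_univ ((hzd C.o).constantCoeff_eq_zero hm.ne'))
  exact ⟨f, fun _ => Submodule.mem_top, hf⟩

/-- For a cycle z = l + u s in I + (u), the boundary ∂s lies in I : u, so ∂s = ∂t' with t' in I : u.
Hence z is the sum of the cycle l + u t' in I and u times the cycle s - t' in S. The latter has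
positive coefficient degree because `U.card ≤ r < m`, so it bounds. -/
theorem RegularityLE.insert [DecidableEq σ] {C : KoszulMatrix K (Set.univ : Set σ)}
    {F : Set (Finset σ)} {U : Finset σ} {r : ℤ} (hr : U.card ≤ r)
    (h₁ : C.RegularityLE HasDegree (sqfreeIdeal K {B | ∃ A ∈ F, A ⊆ B ∪ U}) (r + 1 - U.card))
    (h₂ : C.RegularityLE HasDegree (sqfreeIdeal K F) r) :
    C.RegularityLE HasDegree (sqfreeIdeal K (insert U F)) r := by
  intro m hm z hz hzd hz0
  obtain ⟨l, s, hl, hld, hs, hls⟩ := exists_homogeneous_decomposition hz hzd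
  have hls' : z = fun i => l i + sqfreeMonomial K U * s i := funext hls
  have hbd : ∀ i, sqfreeMonomial K U * C.bd s i = -C.bd l i := by
    intro i
    rw [eq_neg_iff_add_eq_zero, add_comm, ← C.bd_add_mul, ← hls', hz0, Pi.zero_apply]
  obtain ⟨t, ht, hts⟩ := h₁ (m - U.card + 1) (by omega) (C.bd s)
    (fun i => sqfreeMonomial_mul_mem.1 (by
      rw [hbd]
      exact neg_mem (C.bd_mem hl i)))
    (fun i => C.hasDegree_bd hs i) (C.bd_bd s)
  let t' : C.ι → MvPolynomial σ K := fun i => hc (m - U.card) (t i)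
  have ht' : ∀ i, t' i ∈ sqfreeIdeal K {B | ∃ A ∈ F, A ⊆ B ∪ U} :=
    fun i => hc_mem_sqfreeIdeal (ht i) _
  have hts' : C.bd t' = C.bd s := by
    funext i
    rw [← hasDegree_iff_hc.1 (C.hasDegree_bd hs i), ← hts, C.hc_bd, add_sub_cancel_right]
  obtain ⟨q, -, hq⟩ := C.regularityLE_top (m - U.card) (by omega) (s - t')
    (fun _ => Submodule.mem_top)
    (fun i => (hs i).sub (hasDegree_hc _ _))
    (by rw [C.bd_sub, hts', sub_self])
  obtain ⟨c, hc, hcz⟩ := h₂ m hm (fun i => l i + sqfreeMonomial K U * t' i)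
    (fun i => add_mem (hl i) (sqfreeMonomial_mul_mem.2 (ht' i)))
    (fun i => (hld i).add (by
      have := (hasDegree_sqfreeMonomial U).mul (hasDegree_hc (m - U.card) (t i))
      rwa [add_sub_cancel] at this))
    (by
      funext i
      rw [C.bd_add_mul, hts', ← C.bd_add_mul, ← hls', hz0])
  refine ⟨fun i => c i + sqfreeMonomial K U * q i, fun i =>
    mem_sqfreeIdeal_insert.2 ⟨c i, hc i, q i, rfl⟩, ?_⟩
  funext i
  rw [C.bd_add_mul, hcz, hq, hls, Pi.sub_apply]
  ring

end KoszulMatrix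

/-! ### Ideals generated by variables and edges. -/

theorem sqfreeIdeal_eq {F G : Set (Finset σ)} (h : ∀ A ∈ F, ∃ B ∈ G, B ⊆ A)
    (h' : ∀ A ∈ G, ∃ B ∈ F, B ⊆ A) : sqfreeIdeal K F = sqfreeIdeal K G :=
  (sqfreeIdeal_le h).antisymm (sqfreeIdeal_le h')

theorem sqfreeIdeal_eq_top {F : Set (Finset σ)} (h : ∅ ∈ F) : sqfreeIdeal K F = ⊤ :=
  (Ideal.eq_top_iff_one _).2 (Ideal.subset_span ⟨∅, h, by simp [sqfreeMonomial]⟩)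

namespace KoszulMatrix

variable [DecidableEq σ]

theorem regularityLE_singletons (C : KoszulMatrix K (Set.univ : Set σ)) (P : Finset σ) :
    C.RegularityLE HasDegree (sqfreeIdeal K {A | ∃ a ∈ P, A = {a}}) 1 := by
  induction P using Finset.induction_on with
  | empty =>
    intro m _ z hz _ _
    have : ∀ i, z i = 0 := fun i => by simpa [sqfreeIdeal] using hz i
    exact ⟨0, fun _ => zero_mem _, by funext i; simp [bd, this]⟩
  | insert x P hx ih =>
    have : {A : Finset σ | ∃ a ∈ insert x P, A = {a}} =
        insert {x} {A | ∃ a ∈ P, A = {a}} := by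
      ext A
      simp
    rw [this]
    refine RegularityLE.insert (by simp) ?_ ih
    rw [sqfreeIdeal_eq (G := {A | ∃ a ∈ P, A = {a}})]
    · exact ih.mono (by simp)
    · rintro B ⟨A, ⟨a, ha, rfl⟩, hA⟩
      refine ⟨{a}, ⟨a, ha, rfl⟩, ?_⟩
      have hax : a ≠ x := fun h => hx (h ▸ ha)
      simpa [hax] using hA
    · intro A hA
      exact ⟨A, ⟨A, hA, Finset.subset_union_left⟩, subset_rfl⟩

/-- An ideal generated by variables and by edges of a graph on `W` has regularity at most
`⌊|W| / 2⌋ + 1`. -/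
theorem regularityLE_of_card_le_two [Finite σ] (C : KoszulMatrix K (Set.univ : Set σ)) (n : ℕ) :
    ∀ (W : Finset σ) (F : Set (Finset σ)), W.card ≤ n →
      (∀ A ∈ F, A.card ≤ 1 ∨ (A.card = 2 ∧ A ⊆ W)) →
      C.RegularityLE HasDegree (sqfreeIdeal K F) ((n / 2 + 1 : ℕ) : ℤ) := by
  classical
  cases nonempty_fintype σ
  induction n using Nat.strong_induction_on with
  | _ n ih =>
  intro W F hW hF
  by_cases h0 : ∅ ∈ F
  · rw [sqfreeIdeal_eq_top h0]
    exact C.regularityLE_top.mono (by positivity)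
  by_cases h1 : ∃ A ∈ F, A.card = 2 ∧ ∀ a ∈ A, {a} ∉ F
  · obtain ⟨A, hA, hA2, hAF⟩ := h1
    have hAW : A ⊆ W := by
      rcases hF A hA with h | h
      · omega
      · exact h.2
    obtain ⟨x, y, hxy, rfl⟩ := Finset.card_eq_two.1 hA2
    have hxW : x ∈ W := hAW (by simp)
    have hyW : y ∈ W := hAW (by simp)
    have hW2 : 2 ≤ W.card := by
      rw [← hA2]
      exact Finset.card_le_card hAW
    -- Coloning by an endpoint `x` of an edge `{x, y}` puts `y` into the ideal, so both vertices
    -- leave `W`: the halved count drops by one and pays for the degree of `x`. Adding `x` instead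
    -- only removes `x` from `W`.
    refine RegularityLE.of_colon (U := {x}) ?_ ?_
    · have hcard : ((W.erase x).erase y).card ≤ n - 2 := by
        rw [Finset.card_erase_of_mem (Finset.mem_erase.2 ⟨hxy.symm, hyW⟩),
          Finset.card_erase_of_mem hxW]
        omega
      have := ih (n - 2) (by omega) ((W.erase x).erase y)
        (insert {y} {B | y ∉ B ∧ ∃ A ∈ F, B = A.erase x}) hcard (by
          rintro B (rfl | ⟨hyB, A, hA, rfl⟩)
          · simp
          · rcases hF A hA with h | ⟨h, hAW⟩
            · exact Or.inl ((Finset.card_le_card (Finset.erase_subset _ _)).trans h)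
            · by_cases hxA : x ∈ A
              · left
                rw [Finset.card_erase_of_mem hxA, h]
              · right
                rw [Finset.erase_eq_of_notMem hxA] at hyB ⊢
                refine ⟨h, fun a ha => ?_⟩
                rw [Finset.mem_erase, Finset.mem_erase]
                exact ⟨fun h => hyB (h ▸ ha), fun h => hxA (h ▸ ha), hAW ha⟩)
      rw [sqfreeIdeal_eq (G := insert {y} {B | y ∉ B ∧ ∃ A ∈ F, B = A.erase x})]
      · refine this.mono ?_
        rw [Finset.card_singleton]
        omega
      · rintro B ⟨A, hA, hAB⟩
        have hsub : A.erase x ⊆ B := by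
          intro a ha
          rw [Finset.mem_erase] at ha
          have := hAB ha.2
          simp only [Finset.mem_union, Finset.mem_singleton] at this
          tauto
        by_cases hy : y ∈ A.erase x
        · exact ⟨{y}, Or.inl rfl, by simpa using hsub hy⟩
        · exact ⟨_, Or.inr ⟨hy, A, hA, rfl⟩, hsub⟩
      · rintro B (rfl | ⟨-, A, hA, rfl⟩)
        · exact ⟨{y}, ⟨_, hA, by intro a; simp; tauto⟩, subset_rfl⟩
        · refine ⟨_, ⟨A, hA, fun a ha => ?_⟩, subset_rfl⟩
          simp only [Finset.mem_union, Finset.mem_erase, Finset.mem_singleton]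
          tauto
    · have := ih (n - 1) (by omega) (W.erase x) (insert {x} {B | x ∉ B ∧ B ∈ F})
        (by rw [Finset.card_erase_of_mem hxW]; omega) (by
          rintro B (rfl | ⟨hxB, hB⟩)
          · simp
          · refine (hF B hB).imp id fun h => ⟨h.1, fun a ha => ?_⟩
            rw [Finset.mem_erase]
            exact ⟨fun h => hxB (h ▸ ha), h.2 ha⟩)
      rw [sqfreeIdeal_eq (G := insert {x} {B | x ∉ B ∧ B ∈ F})]
      · refine this.mono ?_
        omega
      · rintro B (rfl | hB)
        · exact ⟨_, Or.inl rfl, subset_rfl⟩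
        · by_cases hx : x ∈ B
          · exact ⟨{x}, Or.inl rfl, by simpa using hx⟩
          · exact ⟨B, Or.inr ⟨hx, hB⟩, subset_rfl⟩
      · rintro B (rfl | ⟨-, hB⟩)
        · exact ⟨_, Or.inl rfl, subset_rfl⟩
        · exact ⟨B, Or.inr hB, subset_rfl⟩
  -- Every edge now contains a variable of the ideal, so the variables alone generate.
  · push Not at h1
    rw [sqfreeIdeal_eq (G := {A | ∃ a ∈ Finset.univ.filter (fun a => {a} ∈ F), A = {a}})]
    · refine (C.regularityLE_singletons _).mono ?_
      push_cast
      omega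
    · intro A hA
      rcases hF A hA with h | h
      · have : A.card = 1 := by
          have : A.card ≠ 0 := fun h => h0 (Finset.card_eq_zero.1 h ▸ hA)
          omega
        obtain ⟨a, rfl⟩ := Finset.card_eq_one.1 this
        exact ⟨{a}, ⟨a, by simpa using hA, rfl⟩, subset_rfl⟩
      · obtain ⟨a, ha, haF⟩ := h1 A hA h.1
        exact ⟨{a}, ⟨a, by simpa using haF, rfl⟩, by simpa using ha⟩
    · rintro _ ⟨a, ha, rfl⟩
      exact ⟨{a}, by simpa using ha, subset_rfl⟩

end KoszulMatrix

end GradedRes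
end

noncomputable section

namespace GradedRes

/-! ### Vertex sets with a perfect matching -/

variable {V : Type*} [DecidableEq V]

/-- The induced subgraph on the vertex set has a perfect matching. -/
inductive Matchable (G : SimpleGraph V) : Finset V → Prop
  | nil : Matchable G ∅
  | cons {u v : V} {A : Finset V} (h : G.Adj u v) (hu : u ∉ A) (hv : v ∉ A)
      (hA : Matchable G A) : Matchable G (insert u (insert v A))

variable {G : SimpleGraph V}

theorem Matchable.of_mem_iff {A B : Finset V} (hA : Matchable G A) (h : ∀ a, a ∈ A ↔ a ∈ B) :
    Matchable G B :=
  Finset.ext h ▸ hA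

theorem Matchable.of_erase {u v : V} {A : Finset V} (h : G.Adj u v) (hu : u ∈ A) (hv : v ∈ A)
    (hA : Matchable G ((A.erase u).erase v)) : Matchable G A := by
  have := Matchable.cons h (by simp) (by simp) hA
  rwa [Finset.insert_erase (Finset.mem_erase.2 ⟨h.ne', hv⟩), Finset.insert_erase hu] at this

/-- Any chosen vertex can be taken as an endpoint of the edge split off last, independently of the
order of construction. -/
theorem Matchable.exists_partner {A : Finset V} (hA : Matchable G A) {x : V} (hx : x ∈ A) :
    ∃ z ∈ A, G.Adj x z ∧ Matchable G ((A.erase x).erase z) := by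
  induction hA with
  | nil => simp at hx
  | @cons u v A h hu hv hA ih =>
    have hne := h.ne
    rw [Finset.mem_insert, Finset.mem_insert] at hx
    rcases hx with rfl | rfl | hx
    · refine ⟨v, by simp, h, ?_⟩
      rw [Finset.erase_insert (by simp [hne, hu]), Finset.erase_insert hv]
      exact hA
    · refine ⟨u, by simp, h.symm, ?_⟩
      rw [Finset.erase_right_comm, Finset.erase_insert (by simp [hne, hu]),
        Finset.erase_insert hv]
      exact hA
    · obtain ⟨z, hz, hxz, hm⟩ := ih hx
      refine ⟨z, by simp [hz], hxz, ?_⟩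
      have h1 : u ≠ x := fun h => hu (h ▸ hx)
      have h2 : v ≠ x := fun h => hv (h ▸ hx)
      have h3 : u ≠ z := fun h => hu (h ▸ hz)
      have h4 : v ≠ z := fun h => hv (h ▸ hz)
      rw [Finset.erase_insert_of_ne h1, Finset.erase_insert_of_ne h2,
        Finset.erase_insert_of_ne h3, Finset.erase_insert_of_ne h4]
      exact Matchable.cons h (by simp [hu]) (by simp [hv]) hm

/-- Matchable sets form an even delta-matroid. -/
theorem Matchable.exchange {A B : Finset V} (hA : Matchable G A) (hB : Matchable G B) {x : V}
    (hx : x ∈ symmDiff A B) :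
    ∃ y ∈ symmDiff A B, y ≠ x ∧ Matchable G (symmDiff A {x, y}) := by
  induction hn : A.card using Nat.strong_induction_on generalizing A B x with
  | _ n ih =>
  subst hn
  -- Follow the alternating path from `x` through its partner `z` and then the partner `w` of `z` in
  -- the other matching, stopping at the first vertex in the symmetric difference. Otherwise, delete
  -- both edges and continue from `w`, which now lies in exactly one of the smaller sets; an edge at
  -- `z` is restored afterwards.
  rcases Finset.mem_symmDiff.1 hx with ⟨hxA, hxB⟩ | ⟨hxB, hxA⟩
  · obtain ⟨z, hzA, hxz, hAxz⟩ := hA.exists_partner hxA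
    have hne := hxz.ne
    by_cases hzB : z ∈ B
    · obtain ⟨w, hwB, hzw, hBzw⟩ := hB.exists_partner hzB
      have hne2 := hzw.ne
      have hwx : w ≠ x := fun h => hxB (h ▸ hwB)
      by_cases hwA : w ∈ A
      · obtain ⟨y, hy, hyw, hm⟩ := ih _ (Finset.card_lt_card (by
          refine ⟨(Finset.erase_subset _ _).trans (Finset.erase_subset _ _), fun h => ?_⟩
          have := h hxA
          simp at this)) hAxz hBzw (x := w) (by simp [Finset.mem_symmDiff]; grind) rfl
        simp only [Finset.mem_symmDiff, Finset.mem_erase] at hy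
        refine ⟨y, by simp only [Finset.mem_symmDiff]; grind, by grind, ?_⟩
        refine Matchable.of_erase hzw ?_ ?_ (hm.of_mem_iff fun a => ?_)
        · simp only [Finset.mem_symmDiff, Finset.mem_insert, Finset.mem_singleton]; grind
        · simp only [Finset.mem_symmDiff, Finset.mem_insert, Finset.mem_singleton]; grind
        · simp only [Finset.mem_symmDiff, Finset.mem_insert, Finset.mem_singleton, Finset.mem_erase]; grind
      · refine ⟨w, by simp [Finset.mem_symmDiff, hwA, hwB], hwx, ?_⟩
        refine Matchable.of_erase hzw ?_ ?_ (hAxz.of_mem_iff fun a => ?_)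
        · simp only [Finset.mem_symmDiff, Finset.mem_insert, Finset.mem_singleton]; grind
        · simp only [Finset.mem_symmDiff, Finset.mem_insert, Finset.mem_singleton]; grind
        · simp only [Finset.mem_symmDiff, Finset.mem_insert, Finset.mem_singleton, Finset.mem_erase]; grind
    · refine ⟨z, by simp [Finset.mem_symmDiff, hzA, hzB], hne.symm, hAxz.of_mem_iff fun a => ?_⟩
      simp only [Finset.mem_symmDiff, Finset.mem_insert, Finset.mem_singleton, Finset.mem_erase]
      grind
  · obtain ⟨z, hzB, hxz, hBxz⟩ := hB.exists_partner hxB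
    have hne := hxz.ne
    by_cases hzA : z ∈ A
    · obtain ⟨w, hwA, hzw, hAzw⟩ := hA.exists_partner hzA
      have hne2 := hzw.ne
      have hwx : w ≠ x := fun h => hxA (h ▸ hwA)
      by_cases hwB : w ∈ B
      · obtain ⟨y, hy, hyw, hm⟩ := ih _ (Finset.card_lt_card (by
          refine ⟨(Finset.erase_subset _ _).trans (Finset.erase_subset _ _), fun h => ?_⟩
          have := h hzA
          simp at this)) hAzw hBxz (x := w) (by simp [Finset.mem_symmDiff]; grind) rfl
        simp only [Finset.mem_symmDiff, Finset.mem_erase] at hy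
        refine ⟨y, by simp only [Finset.mem_symmDiff]; grind, by grind, ?_⟩
        refine Matchable.of_erase hxz ?_ ?_ (hm.of_mem_iff fun a => ?_)
        · simp only [Finset.mem_symmDiff, Finset.mem_insert, Finset.mem_singleton]; grind
        · simp only [Finset.mem_symmDiff, Finset.mem_insert, Finset.mem_singleton]; grind
        · simp only [Finset.mem_symmDiff, Finset.mem_insert, Finset.mem_singleton, Finset.mem_erase]; grind
      · refine ⟨w, by simp [Finset.mem_symmDiff, hwA, hwB], hwx, ?_⟩
        refine Matchable.of_erase hxz ?_ ?_ (hAzw.of_mem_iff fun a => ?_)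
        · simp only [Finset.mem_symmDiff, Finset.mem_insert, Finset.mem_singleton]; grind
        · simp only [Finset.mem_symmDiff, Finset.mem_insert, Finset.mem_singleton]; grind
        · simp only [Finset.mem_symmDiff, Finset.mem_insert, Finset.mem_singleton, Finset.mem_erase]; grind
    · refine ⟨z, by simp [Finset.mem_symmDiff, hzA, hzB], hne.symm, ?_⟩
      refine Matchable.of_erase hxz ?_ ?_ (hA.of_mem_iff fun a => ?_)
      · simp only [Finset.mem_symmDiff, Finset.mem_insert, Finset.mem_singleton]; grind
      · simp only [Finset.mem_symmDiff, Finset.mem_insert, Finset.mem_singleton]; grind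
      · simp only [Finset.mem_symmDiff, Finset.mem_insert, Finset.mem_singleton, Finset.mem_erase]; grind

end GradedRes
end

noncomputable section

namespace GradedRes

open MvPolynomial

/-! ### Exchange and augmentation for matchable sets. -/

section Exchange

variable {V : Type*} [DecidableEq V] {G : SimpleGraph V}

theorem Matchable.exchange_or_augment {A B : Finset V} (hA : Matchable G A) (hB : Matchable G B)
    {b : V} (hb : b ∈ A \ B) :
    (∃ a ∈ B \ A, Matchable G (insert b (B.erase a))) ∨
      ∃ b' ∈ A \ B, b' ≠ b ∧ Matchable G (insert b (insert b' B)) := by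
  rw [Finset.mem_sdiff] at hb
  obtain ⟨y, hy, hne, hm⟩ := hB.exchange hA (x := b) (by simp [Finset.mem_symmDiff, hb])
  rcases Finset.mem_symmDiff.1 hy with h | h
  · refine Or.inl ⟨y, Finset.mem_sdiff.2 h, hm.of_mem_iff fun a => ?_⟩
    simp only [Finset.mem_symmDiff, Finset.mem_insert, Finset.mem_singleton, Finset.mem_erase]
    grind
  · refine Or.inr ⟨y, Finset.mem_sdiff.2 h, hne, hm.of_mem_iff fun a => ?_⟩
    simp only [Finset.mem_symmDiff, Finset.mem_insert, Finset.mem_singleton]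
    grind

/-- `A` is moved towards `B` until it contains `B`; then no exchange is possible and
`exchange_or_augment` must augment. -/
theorem Matchable.exists_augment {A B : Finset V} (hA : Matchable G A) (hB : Matchable G B)
    (hcard : B.card < A.card) :
    ∃ b ∈ A \ B, ∃ b' ∈ A \ B, b' ≠ b ∧ Matchable G (insert b (insert b' B)) := by
  induction hn : (B \ A).card using Nat.strong_induction_on generalizing A with
  | _ n ih =>
  subst hn
  by_cases hsub : B ⊆ A
  · obtain ⟨b, hb⟩ : (A \ B).Nonempty := by
      rw [Finset.sdiff_nonempty]
      exact fun h => hcard.not_ge (Finset.card_le_card h)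
    rcases hA.exchange_or_augment hB hb with ⟨a, ha, -⟩ | ⟨b', hb', hne, hm⟩
    · rw [Finset.mem_sdiff] at ha
      exact absurd (hsub ha.1) ha.2
    · exact ⟨b, hb, b', hb', hne, hm⟩
  · obtain ⟨x, hxB, hxA⟩ := Finset.not_subset.1 hsub
    have hx : x ∈ B \ A := Finset.mem_sdiff.2 ⟨hxB, hxA⟩
    -- A replacement for `A` may acquire only elements of `B`, so augmenting vertices found for it
    -- also serve for `A`.
    have key : ∀ A' : Finset V, Matchable G A' → A.card ≤ A'.card → x ∈ A' →
        A' \ B ⊆ A \ B → B \ A' ⊆ B \ A →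
        ∃ b ∈ A \ B, ∃ b' ∈ A \ B, b' ≠ b ∧ Matchable G (insert b (insert b' B)) := by
      intro A' hA' hle hxA' h1 h2
      obtain ⟨b, hb, b', hb', hne, hm⟩ := ih _ (Finset.card_lt_card ⟨h2, fun h => by
        have := h hx
        rw [Finset.mem_sdiff] at this
        exact this.2 hxA'⟩) hA' (hcard.trans_le hle) rfl
      exact ⟨b, h1 hb, b', h1 hb', hne, hm⟩
    rcases hB.exchange_or_augment hA hx with ⟨a, ha, hm⟩ | ⟨b', hb', hne, hm⟩
    · rw [Finset.mem_sdiff] at ha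
      refine key _ hm ?_ (by simp) ?_ ?_
      · rw [Finset.card_insert_of_notMem (by simp [hxA]), Finset.card_erase_of_mem ha.1]
        omega
      · intro c
        simp only [Finset.mem_sdiff, Finset.mem_insert, Finset.mem_erase]
        grind
      · intro c
        simp only [Finset.mem_sdiff, Finset.mem_insert, Finset.mem_erase]
        grind
    · refine key _ hm (Finset.card_le_card fun c hc => by simp [hc]) (by simp) ?_ ?_
      · rw [Finset.mem_sdiff] at hb'
        intro c
        simp only [Finset.mem_sdiff, Finset.mem_insert]
        grind
      · intro c
        simp only [Finset.mem_sdiff, Finset.mem_insert]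
        grind

theorem Matchable.exists_subset_card {A : Finset V} (hA : Matchable G A) {s : ℕ}
    (hs : A.card = 2 * (s + 1)) : ∃ B ⊆ A, Matchable G B ∧ B.card = 2 * s := by
  obtain ⟨x, hx⟩ : A.Nonempty := Finset.card_pos.1 (by omega)
  obtain ⟨z, hz, hxz, hm⟩ := hA.exists_partner hx
  refine ⟨_, (Finset.erase_subset _ _).trans (Finset.erase_subset _ _), hm, ?_⟩
  rw [Finset.card_erase_of_mem (Finset.mem_erase.2 ⟨hxz.ne', hz⟩), Finset.card_erase_of_mem hx]
  omega

end Exchange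

/-! ### Regularity of the ideal of matchable sets -/

/-- The vertex sets of the matchings with `s` edges. -/
def matchableSets {V : Type*} [DecidableEq V] (G : SimpleGraph V) (s : ℕ) : Set (Finset V) :=
  {A | Matchable G A ∧ A.card = 2 * s}

variable {V K : Type*} [Field K]

/-- The hypothesis says that the colon by `B` is generated in degrees at most two by sets outside
`B`, so the bound for variables and edges applies on the complement. -/
theorem KoszulMatrix.regularityLE_colon [Fintype V] [DecidableEq V]
    (C : KoszulMatrix K (Set.univ : Set V)) {F : Set (Finset V)} {B : Finset V}
    (h : ∀ A ∈ F, ∃ D ⊆ A \ B, D.card ≤ 2 ∧ ∃ A' ∈ F, A' ⊆ D ∪ B) :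
    C.RegularityLE HasDegree (sqfreeIdeal K {D | ∃ A ∈ F, A ⊆ D ∪ B})
      (((Fintype.card V - B.card) / 2 + 1 : ℕ) : ℤ) := by
  have := C.regularityLE_of_card_le_two (Fintype.card V - B.card) Bᶜ
    {D | D.card ≤ 2 ∧ D ⊆ Bᶜ ∧ ∃ A ∈ F, A ⊆ D ∪ B} (Finset.card_compl B).le
    (fun D hD => by
      rcases Nat.lt_or_ge D.card 2 with h | h
      · exact Or.inl (by omega)
      · exact Or.inr ⟨le_antisymm hD.1 h, hD.2.1⟩)
  convert this using 1
  refine sqfreeIdeal_eq ?_ fun D hD => ⟨D, hD.2.2, subset_rfl⟩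
  · rintro E ⟨A, hA, hAE⟩
    obtain ⟨D, hDA, hD2, hD⟩ := h A hA
    refine ⟨D, ⟨hD2, fun a ha => ?_, hD⟩, fun a ha => ?_⟩
    · rw [Finset.mem_compl]
      exact (Finset.mem_sdiff.1 (hDA ha)).2
    · have h1 := Finset.mem_sdiff.1 (hDA ha)
      exact (Finset.mem_union.1 (hAE h1.1)).resolve_right h1.2

variable [LinearOrder V] {G : SimpleGraph V}

/-- The colon ideals that arise when the vertex sets of `s`-matchings are removed one by one, in
increasing colexicographic order, are generated in degrees at most two. -/
theorem exists_small_subset {s : ℕ} {t : Set (Colex (Finset V))} {B : Finset V}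
    (hB : B ∈ matchableSets G s)
    (ht : ∀ A, A ∈ t ↔ ofColex A ∈ matchableSets G s ∧ toColex B < A) :
    ∀ A ∈ matchableSets G (s + 1) ∪ ofColex '' t, ∃ D ⊆ A \ B, D.card ≤ 2 ∧
      ∃ A' ∈ matchableSets G (s + 1) ∪ ofColex '' t, A' ⊆ D ∪ B := by
  have haug : ∀ b b' : V, ∀ A : Finset V, b ∈ A \ B → b' ∈ A \ B → b' ≠ b →
      Matchable G (insert b (insert b' B)) → ∃ D ⊆ A \ B, D.card ≤ 2 ∧
      ∃ A' ∈ matchableSets G (s + 1) ∪ ofColex '' t, A' ⊆ D ∪ B := by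
    intro b b' A hb hb' hne hm
    refine ⟨{b, b'}, by simp [Finset.insert_subset_iff, hb, hb'], Finset.card_le_two,
      insert b (insert b' B), Or.inl ⟨hm, ?_⟩, ?_⟩
    · rw [Finset.mem_sdiff] at hb hb'
      rw [Finset.card_insert_of_notMem (by simp [hne.symm, hb.2]),
        Finset.card_insert_of_notMem hb'.2, hB.2]
      ring
    · intro c
      simp only [Finset.mem_insert, Finset.mem_union, Finset.mem_singleton]
      tauto
  rintro A (⟨hA, hAs⟩ | ⟨A, hA, rfl⟩)
  · obtain ⟨b, hb, b', hb', hne, hm⟩ := hA.exists_augment hB.1 (by rw [hAs, hB.2]; omega)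
    exact haug b b' A hb hb' hne hm
  · obtain ⟨⟨hA, hAs⟩, hlt⟩ := (ht A).1 hA
    -- The vertex `b` exceeds all of `B \ A`. Hence any exchange of some `a ∈ B \ A` for `b` moves
    -- `B` up in colex order, and the resulting set is still among the retained generators.
    obtain ⟨b, hbA, hbB, hmax⟩ := Finset.Colex.toColex_lt_toColex_iff_exists_forall_lt.1
      (show toColex B < toColex (ofColex A) from hlt)
    have hb : b ∈ ofColex A \ B := Finset.mem_sdiff.2 ⟨hbA, hbB⟩
    rcases hA.exchange_or_augment hB.1 hb with ⟨a, ha, hm⟩ | ⟨b', hb', hne, hm⟩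
    · rw [Finset.mem_sdiff] at ha
      refine ⟨{b}, by simpa using hb, by simp, insert b (B.erase a),
        Or.inr ⟨toColex (insert b (B.erase a)), (ht _).2 ⟨⟨hm, ?_⟩, ?_⟩, rfl⟩, ?_⟩
      · change (insert b (B.erase a)).card = _
        rw [Finset.card_insert_of_notMem (by simp [hbB]), Finset.card_erase_of_mem ha.1, ← hB.2]
        have := Finset.card_pos.2 ⟨a, ha.1⟩
        omega
      · refine Finset.Colex.toColex_lt_toColex_iff_exists_forall_lt.2
          ⟨b, by simp, hbB, fun c hc hcn => ?_⟩
        have : c = a := by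
          simp only [Finset.mem_insert, Finset.mem_erase] at hcn
          tauto
        subst this
        exact hmax c ha.1 ha.2
      · intro c
        simp only [Finset.mem_insert, Finset.mem_erase, Finset.mem_union, Finset.mem_singleton]
        tauto
    · exact haug b b' _ hb hb' hne hm

/-- The `s`-sets are stripped from I(G)^[s] one at a time with `of_colon`, leaving I(G)^[s+1]. -/
theorem KoszulMatrix.regularityLE_matchableSets_succ [Fintype V]
    (C : KoszulMatrix K (Set.univ : Set V)) {s : ℕ} {r : ℤ} (hr : (s + 1 + Fintype.card V / 2 : ℕ) ≤ r)
    (h : C.RegularityLE HasDegree (sqfreeIdeal K (matchableSets G s)) r) :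
    C.RegularityLE HasDegree (sqfreeIdeal K (matchableSets G (s + 1))) r := by
  classical
  -- Here `t` is an upper set among the `s`-sets, so removing its minimum `B` leaves exactly the
  -- `s`-sets above `B`, as `exists_small_subset` requires.
  have key : ∀ t : Finset (Colex (Finset V)), (∀ A ∈ t, ofColex A ∈ matchableSets G s) →
      (∀ A ∈ t, ∀ B, ofColex B ∈ matchableSets G s → A < B → B ∈ t) →
      C.RegularityLE HasDegree
        (sqfreeIdeal K (matchableSets G (s + 1) ∪ ofColex '' (t : Set (Colex (Finset V))))) r →
      C.RegularityLE HasDegree (sqfreeIdeal K (matchableSets G (s + 1))) r := by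
    intro t
    induction t using Finset.induction_on_min with
    | empty => simp
    | insert B t hlt ih =>
      intro hM hup hreg
      refine ih (fun A hA => hM A (Finset.mem_insert_of_mem hA)) (fun A hA D hD hAD => ?_) ?_
      · refine (Finset.mem_insert.1 (hup A (Finset.mem_insert_of_mem hA) D hD hAD)).resolve_left ?_
        exact ((hlt A hA).trans hAD).ne'
      · have hB := hM B (Finset.mem_insert_self _ _)
        refine RegularityLE.of_colon (U := ofColex B) ?_ ?_
        · refine (C.regularityLE_colon (exists_small_subset hB fun A => ⟨fun hA =>
            ⟨hM A (Finset.mem_insert_of_mem hA), hlt A hA⟩, fun hA => ?_⟩)).mono ?_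
          · exact (Finset.mem_insert.1 (hup B (Finset.mem_insert_self _ _) A hA.1
              hA.2)).resolve_left (ne_of_gt hA.2)
          -- Since |B| = 2s ≤ n, (n - 2s)/2 + 1 + 2s = s + 1 + n/2 with integer division.
          · have h1 := hB.2
            have h2 := Finset.card_le_univ (ofColex B)
            omega
        · rwa [Finset.coe_insert, Set.image_insert_eq, Set.union_insert] at hreg
  have hfin : {A : Colex (Finset V) | ofColex A ∈ matchableSets G s}.Finite :=
    (Set.toFinite (matchableSets G s)).preimage ofColex.injective.injOn
  -- With all `s`-sets present the ideal is I(G)^[s], since every matchable (s+1)-set contains a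
  -- matchable `s`-set.
  refine key hfin.toFinset (by simp) (fun A _ B hB _ => by simpa using hB) ?_
  rw [Set.Finite.coe_toFinset]
  convert h using 1
  refine (sqfreeIdeal_eq ?_ ?_).symm
  · intro A hA
    exact ⟨A, Or.inr ⟨toColex A, hA, rfl⟩, subset_rfl⟩
  · rintro A (hA | ⟨A, hA, rfl⟩)
    · obtain ⟨B, hBA, hB⟩ := hA.1.exists_subset_card hA.2
      exact ⟨B, hB, hBA⟩
    · exact ⟨_, hA, subset_rfl⟩

theorem KoszulMatrix.regularityLE_matchableSets [Fintype V]
    (C : KoszulMatrix K (Set.univ : Set V)) (G : SimpleGraph V) (s : ℕ) :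
    C.RegularityLE HasDegree (sqfreeIdeal K (matchableSets G s))
      (s + Fintype.card V / 2 : ℕ) := by
  induction s with
  | zero =>
    rw [sqfreeIdeal_eq_top (F := matchableSets G 0) ⟨Matchable.nil, by simp⟩]
    exact C.regularityLE_top.mono (by positivity)
  | succ s ih =>
    refine C.regularityLE_matchableSets_succ le_rfl (ih.mono ?_)
    omega

/-! ### Squarefree powers of edge ideals -/

/-- The exponents of the products of `s` edges. -/
def edgeProducts {V : Type*} (G : SimpleGraph V) : ℕ → Set (V →₀ ℕ)
  | 0 => {0}
  | s + 1 => {μ | ∃ u v ν, G.Adj u v ∧ ν ∈ edgeProducts G s ∧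
      μ = Finsupp.single u 1 + Finsupp.single v 1 + ν}

theorem edgeIdeal_pow_le {V : Type*} (G : SimpleGraph V) (s : ℕ) :
    edgeIdeal K G ^ s ≤ Ideal.span ((fun ν => monomial ν (1 : K)) '' edgeProducts G s) := by
  induction s with
  | zero =>
    simp [edgeProducts]
  | succ s ih =>
    rw [pow_succ']
    refine (Ideal.mul_mono_right ih).trans ?_
    rw [edgeIdeal, Ideal.span_mul_span', Ideal.span_le]
    rintro _ ⟨_, ⟨u, v, h, rfl⟩, _, ⟨ν, hν, rfl⟩, rfl⟩
    exact Ideal.subset_span ⟨_, ⟨u, v, ν, h, hν, rfl⟩, by simp [X, monomial_mul]⟩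

/-- If a product of edges is squarefree, no two of its edges share a vertex, so they form a
matching. -/
theorem matchable_support_of_mem_edgeProducts {s : ℕ} {ν : V →₀ ℕ} (hν : ν ∈ edgeProducts G s)
    (h1 : ∀ a, ν a ≤ 1) : ν.support ∈ matchableSets G s := by
  induction s generalizing ν with
  | zero =>
    rw [edgeProducts, Set.mem_singleton_iff] at hν
    subst hν
    exact ⟨by simpa using Matchable.nil, by simp⟩
  | succ s ih =>
    obtain ⟨u, v, ν, huv, hν, rfl⟩ := hν
    have hne := huv.ne
    have h2 : ∀ a, (if u = a then 1 else 0) + (if v = a then 1 else 0) + ν a ≤ 1 := by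
      intro a
      simpa [Finsupp.single_apply] using h1 a
    obtain ⟨hm, hc⟩ := ih hν fun a => le_of_add_le_right (h2 a)
    have hu : u ∉ ν.support := by
      have := h2 u
      rw [if_pos rfl] at this
      rw [Finsupp.notMem_support_iff]
      omega
    have hv : v ∉ ν.support := by
      have := h2 v
      rw [if_pos rfl] at this
      rw [Finsupp.notMem_support_iff]
      omega
    have hsupp : (Finsupp.single u 1 + Finsupp.single v 1 + ν).support =
        insert u (insert v ν.support) := by
      ext a
      simp only [Finsupp.mem_support_iff, Finsupp.add_apply, Finsupp.single_apply,
        Finset.mem_insert]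
      split_ifs <;> grind
    rw [hsupp]
    refine ⟨Matchable.cons huv hu hv hm, ?_⟩
    rw [Finset.card_insert_of_notMem (by simp only [Finset.mem_insert]; tauto),
      Finset.card_insert_of_notMem hv, hc]
    ring

theorem Matchable.sqfreeMonomial_mem {A : Finset V} (hA : Matchable G A) {s : ℕ}
    (hs : A.card = 2 * s) : sqfreeMonomial K A ∈ edgeIdeal K G ^ s := by
  induction hA generalizing s with
  | nil =>
    obtain rfl : s = 0 := by simpa using hs
    simp
  | @cons u v A h hu hv hA ih =>
    have hu' : u ∉ insert v A := by
      have := h.ne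
      simp only [Finset.mem_insert]
      tauto
    rw [Finset.card_insert_of_notMem hu', Finset.card_insert_of_notMem hv] at hs
    obtain ⟨s, rfl⟩ : ∃ s', s = s' + 1 := ⟨s - 1, by omega⟩
    rw [sqfreeMonomial, Finset.prod_insert hu', Finset.prod_insert hv, ← mul_assoc, pow_succ']
    exact Ideal.mul_mem_mul (Ideal.subset_span ⟨u, v, h, rfl⟩) (ih (by omega))

theorem squarefreePower_edgeIdeal (s : ℕ) :
    squarefreePower (edgeIdeal K G) s = sqfreeIdeal K (matchableSets G s) := by
  apply le_antisymm
  · rw [squarefreePower, Ideal.span_le]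
    rintro _ ⟨hp, A, rfl⟩
    change sqfreeMonomial K A ∈ _ at hp
    change sqfreeMonomial K A ∈ sqfreeIdeal K _
    have hmem := edgeIdeal_pow_le G s hp
    rw [sqfreeMonomial_eq, mem_ideal_span_monomial_image] at hmem
    obtain ⟨ν, hν, hle⟩ := hmem (sqfreeExponent A) (by simp)
    rw [mem_sqfreeIdeal, sqfreeMonomial_eq]
    intro μ hμ
    rw [Finset.mem_singleton.1 (support_monomial_subset hμ)]
    refine ⟨ν.support, matchable_support_of_mem_edgeProducts hν fun a => (hle a).trans ?_,
      Finsupp.support_mono hle⟩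
    rw [sqfreeExponent_apply]
    split_ifs <;> simp
  · rw [sqfreeIdeal, Ideal.span_le]
    rintro _ ⟨A, ⟨hA, hs⟩, rfl⟩
    exact Ideal.subset_span ⟨hA.sqfreeMonomial_mem hs, A, rfl⟩

end GradedRes

end

/-! ### The main theorem. -/

theorem mainTheorem1 {K : Type*} [Field K] {V : Type*} [Fintype V] (G : SimpleGraph V) :
    (∀ s : ℕ, 1 ≤ s → s ≤ GradedRes.matchingNumber G →
      GradedRes.regularity
          (GradedRes.squarefreePower (GradedRes.edgeIdeal K G) s)
          (GradedRes.squarefreePower_isHomogeneous (GradedRes.edgeIdeal K G) s)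
        ≤ ((s + Fintype.card V / 2 : ℕ) : EReal)) ∧
    ((∃ M : G.Subgraph, M.IsMatching ∧ M.edgeSet.ncard = Fintype.card V / 2) →
      ∀ s : ℕ, 1 ≤ s → s ≤ GradedRes.matchingNumber G →
        GradedRes.regularity
            (GradedRes.squarefreePower (GradedRes.edgeIdeal K G) s)
            (GradedRes.squarefreePower_isHomogeneous (GradedRes.edgeIdeal K G) s)
          ≤ ((GradedRes.matchingNumber G + s : ℕ) : EReal)) := by
  have main : ∀ s : ℕ, GradedRes.regularity
      (GradedRes.squarefreePower (GradedRes.edgeIdeal K G) s)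
      (GradedRes.squarefreePower_isHomogeneous (GradedRes.edgeIdeal K G) s)
        ≤ ((s + Fintype.card V / 2 : ℕ) : EReal) := by
    intro s
    -- An arbitrary vertex order, needed only to define the colex order.
    let _ : LinearOrder V := LinearOrder.lift' (Fintype.equivFin V) (Fintype.equivFin V).injective
    obtain ⟨C⟩ := GradedRes.nonempty_koszulMatrix (K := K) (Finset.univ : Finset V)
    rw [Finset.coe_univ] at C
    refine GradedRes.regularity_le_of_regularityLE (C := C) _ ?_
    rw [GradedRes.squarefreePower_edgeIdeal]
    exact C.regularityLE_matchableSets G s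
  refine ⟨fun s _ _ => main s, ?_⟩
  rintro ⟨M, hM, hcard⟩ s - -
  have hle : Fintype.card V / 2 ≤ GradedRes.matchingNumber G := by
    -- The supremum in ℕ dominates its members only for a bounded set; the number of unordered pairs
    -- is a bound.
    refine le_csSup ⟨Nat.card (Sym2 V), ?_⟩ ⟨M, hM, hcard⟩
    rintro _ ⟨M', -, rfl⟩
    exact Set.ncard_le_card M'.edgeSet
  refine (main s).trans ?_
  exact_mod_cast (by omega : s + Fintype.card V / 2 ≤ GradedRes.matchingNumber G + s)
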